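/- Let $d\ge 1$ and let $x\in\mathbb C^d$ be a unit vector, so that $U=\mathbb 1-2|x\rangle\langle x|$ is a unitary $d\times d$ matrix, and put $\omega=\max_i|x_i|^2$. For a unitary $V$ with columns $|v_i\rangle=V|i\rangle$, let $\mathcal P_V(\rho)=\sum_{i=1}^d\langle v_i|\rho|v_i\rangle\,|i\rangle\langle i|$ be the measure-and-prepare channel of the corresponding von Neumann measurement. For a linear map $\Phi:M_d\to M_d$ let $\|\Phi\|_\diamond=\max_{\|X\|_1=1}\|(\Phi\otimes\mathrm{id}_d)(X)\|_1$, where $\|\cdot\|_1$ is the trace norm, and let $J(\Phi)=\sum_{i,j}\Phi(|i\rangle\langle j|)\otimes|i\rangle\langle j|$. A state (density matrix) $\rho$ is called a discriminator of $\Phi$ if $\|\Phi\|_\diamond=\|(\mathbb 1\otimes\sqrt\rho)J(\Phi)(\mathbb 1\otimes\sqrt\rho)\|_1$. Two channels $\Phi,\Psi$ are perfectly distinguishable if, for some finite-dimensional ancilla and some state $\sigma$ on input $\otimes$ ancilla, a binary measurement on output $\otimes$ ancilla tells $(\Phi\otimes\mathrm{id})(\sigma)$ from $(\Psi\otimes\mathrm{id})(\sigma)$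 with probability one. Then: 1. $\mathcal P_U$ and $\mathcal P_{\mathbb 1}$ are perfectly distinguishable if and only if $\omega\le\frac12$; likewise, $\|\mathcal P_U-\mathcal P_{\mathbb 1}\|_\diamond=2$ if and only if $\omega\le\frac12$. 2. $\mathcal P_U-\mathcal P_{\mathbb 1}$ has a discriminator $\rho$ with $\operatorname{rank}(\rho)\le 2$; in particular, if $\omega\le\frac12$, perfect discrimination is achieved by a discriminator of rank at most two. 3. Perfect discrimination is achieved by a discriminator of rank one (that is, $\|\mathcal P_U-\mathcal P_{\mathbb 1}\|_\diamond=2$ and $\mathcal P_U-\mathcal P_{\mathbb 1}$ has a discriminator $\rho$ with $\operatorname{rank}(\rho)=1$) if and only if there is a subset $\Delta$ of the index set with $\sum_{i\in\Delta}|x_i|^2=\frac12$. 4. If $\omega>\frac12$, then $\|\mathcal P_U-\mathcal P_{\mathbb 1}\|_\diamond=2\sqrt{1-4(\omega-\frac12)^2}$. -/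

import Mathlib

open Matrix
open scoped Kronecker MatrixOrder ComplexOrder

namespace QMeas

noncomputable section

section Basic

variable {m n k : Type*}

/-- The map `Φ ⊗ id`, where `id` is the identity map on matrices indexed by `k`:
on the block matrix `X = ∑ a b, X_{ab} ⊗ |a⟩⟨b|` it acts as `∑ a b, Φ(X_{ab}) ⊗ |a⟩⟨b|`. -/
def amplify (k : Type*) (Φ : Matrix m m ℂ →ₗ[ℂ] Matrix n n ℂ) :
    Matrix (m × k) (m × k) ℂ →ₗ[ℂ] Matrix (n × k) (n × k) ℂ where
  toFun X := Matrix.of fun p q =>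
    Φ (Matrix.of fun i j => X (i, p.2) (j, q.2)) p.1 q.1
  map_add' X Y := by
    ext p q
    have h : (Matrix.of fun i j => (X + Y) (i, p.2) (j, q.2)) =
        (Matrix.of fun i j => X (i, p.2) (j, q.2)) +
          (Matrix.of fun i j => Y (i, p.2) (j, q.2)) := by
      ext i j; rfl
    simp only [Matrix.of_apply, Matrix.add_apply]
    rw [← Matrix.add_apply, ← map_add]
    rfl
  map_smul' c X := by
    ext p q
    simp only [Matrix.of_apply, Matrix.smul_apply, RingHom.id_apply]
    rw [← Matrix.smul_apply, ← map_smul]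
    rfl

theorem amplify_kronecker (Φ : Matrix m m ℂ →ₗ[ℂ] Matrix n n ℂ) (A : Matrix m m ℂ)
    (B : Matrix k k ℂ) : amplify k Φ (A ⊗ₖ B) = Φ A ⊗ₖ B := by
  ext p q
  have h : (Matrix.of fun i j => (A ⊗ₖ B) (i, p.2) (j, q.2)) = B p.2 q.2 • A := by
    ext i j
    simp [mul_comm]
  change Φ (Matrix.of fun i j => (A ⊗ₖ B) (i, p.2) (j, q.2)) p.1 q.1 = _
  rw [h, map_smul]
  simp [mul_comm]

theorem trace_gram [Fintype n] (A : Matrix n n ℂ) : (Aᴴ * A).trace.re = ∑ i, ∑ j, ‖A i j‖ ^ 2 := by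
  rw [Finset.sum_comm]
  simp only [Matrix.trace, Matrix.diag, Matrix.mul_apply, Matrix.conjTranspose_apply,
    Complex.re_sum]
  refine Finset.sum_congr rfl fun i _ => Finset.sum_congr rfl fun j _ => ?_
  rw [Complex.star_def, Complex.conj_mul', ← Complex.ofReal_pow, Complex.ofReal_re]

variable [Fintype m] [DecidableEq m] [Fintype n] [DecidableEq n]

/-- Density matrices (quantum states): positive semidefinite of trace one. -/
def IsState (ρ : Matrix n n ℂ) : Prop :=
  ρ.PosSemidef ∧ ρ.trace = 1

/-- The trace norm `‖A‖₁ = tr √(A† A)` of a square complex matrix. -/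
def traceNorm (A : Matrix n n ℂ) : ℝ :=
  (CFC.sqrt (Aᴴ * A)).trace.re

/-- The values `‖(Φ ⊗ id)(X)‖₁` over all `X` with `‖X‖₁ = 1`, where `id` is the identity map on
matrices of the same size as the input of `Φ`. -/
def diamondSet (Φ : Matrix m m ℂ →ₗ[ℂ] Matrix n n ℂ) : Set ℝ :=
  {r | ∃ X : Matrix (m × m) (m × m) ℂ, traceNorm X = 1 ∧ traceNorm (amplify m Φ X) = r}

/-- The diamond norm (completely bounded trace norm) of a linear map between matrix spaces. -/
def diamondNorm (Φ : Matrix m m ℂ →ₗ[ℂ] Matrix n n ℂ) : ℝ :=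
  sSup (diamondSet Φ)

theorem sqrt_gram_posSemidef (A : Matrix n n ℂ) : (CFC.sqrt (Aᴴ * A)).PosSemidef :=
  (CFC.sqrt_nonneg (Aᴴ * A)).posSemidef

theorem sqrt_gram_sq (A : Matrix n n ℂ) :
    CFC.sqrt (Aᴴ * A) * CFC.sqrt (Aᴴ * A) = Aᴴ * A :=
  CFC.sqrt_mul_sqrt_self _ (Matrix.posSemidef_conjTranspose_mul_self A).nonneg

theorem sum_sq_sqrt_gram (A : Matrix n n ℂ) :
    ∑ i, ∑ j, ‖CFC.sqrt (Aᴴ * A) i j‖ ^ 2 = ∑ i, ∑ j, ‖A i j‖ ^ 2 := by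
  rw [← trace_gram, ← trace_gram, (sqrt_gram_posSemidef A).1.eq, sqrt_gram_sq]

theorem sum_sq_le_traceNorm_sq (A : Matrix n n ℂ) :
    ∑ i, ∑ j, ‖A i j‖ ^ 2 ≤ traceNorm A ^ 2 := by
  rw [← sum_sq_sqrt_gram]
  have hS := sqrt_gram_posSemidef A
  change _ ≤ (CFC.sqrt (Aᴴ * A)).trace.re ^ 2
  set S := CFC.sqrt (Aᴴ * A)
  have h : ∀ i j, ‖S i j‖ ^ 2 ≤ (S i i).re * (S j j).re := fun i j => by
    have h1 := (hS.submatrix ![i, j]).det_nonneg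
    have hd : ∀ l, (S l l).im = 0 := fun l => by
      have := (Complex.nonneg_iff.1 (hS.diag_nonneg (i := l))).2
      exact this.symm
    rw [Matrix.det_fin_two] at h1
    simp only [Matrix.submatrix_apply, Matrix.cons_val_zero, Matrix.cons_val_one] at h1
    have h2 : S j i = star (S i j) := (hS.1.apply j i).symm
    rw [h2, Complex.star_def, Complex.mul_conj'] at h1
    have h3 := (Complex.nonneg_iff.1 h1).1
    rw [← Complex.ofReal_pow, Complex.sub_re, Complex.ofReal_re, Complex.mul_re, hd i, hd j] at h3
    linarith
  calc ∑ i, ∑ j, ‖S i j‖ ^ 2 ≤ ∑ i, ∑ j, (S i i).re * (S j j).re :=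
        Finset.sum_le_sum fun i _ => Finset.sum_le_sum fun j _ => h i j
    _ = S.trace.re ^ 2 := by
        rw [← Finset.sum_mul_sum, sq]
        simp only [Matrix.trace, Matrix.diag, Complex.re_sum]

theorem traceNorm_le (A : Matrix n n ℂ) :
    traceNorm A ≤ Fintype.card n * √(∑ i, ∑ j, ‖A i j‖ ^ 2) := by
  rw [← sum_sq_sqrt_gram]
  set S := CFC.sqrt (Aᴴ * A)
  change S.trace.re ≤ _
  have h : ∀ i, (S i i).re ≤ √(∑ i, ∑ j, ‖S i j‖ ^ 2) := fun i => by
    refine (Complex.re_le_norm _).trans (Real.le_sqrt_of_sq_le ?_)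
    refine (Finset.single_le_sum (f := fun j => ‖S i j‖ ^ 2) (fun j _ => by positivity)
      (Finset.mem_univ i)).trans ?_
    exact Finset.single_le_sum (f := fun i => ∑ j, ‖S i j‖ ^ 2) (fun j _ => by positivity)
      (Finset.mem_univ i)
  simp only [Matrix.trace, Matrix.diag, Complex.re_sum]
  refine (Finset.sum_le_sum fun i _ => h i).trans ?_
  simp

/-- The set of values in the definition of the diamond norm is bounded. -/
theorem bddAbove_diamondSet (Φ : Matrix m m ℂ →ₗ[ℂ] Matrix n n ℂ) :
    BddAbove (diamondSet Φ) := by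
  have hL : Continuous (amplify m Φ) := LinearMap.continuous_of_finiteDimensional _
  have hK : IsCompact {X : Matrix (m × m) (m × m) ℂ | ∀ p q, X p q ∈ Metric.closedBall 0 1} := by
    refine (isCompact_univ_pi (X := fun _ : m × m => m × m → ℂ)
      (s := fun _ => Set.univ.pi fun _ => Metric.closedBall (0 : ℂ) 1)
      fun _ => isCompact_univ_pi fun _ => isCompact_closedBall _ _).of_isClosed_subset ?_ ?_
    · simp only [Set.ofPred_forall]
      exact isClosed_iInter fun p => isClosed_iInter fun q =>
        Metric.isClosed_closedBall.preimage (continuous_id.matrix_elem p q)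
    · exact fun X hX p _ q _ => hX p q
  have hf : Continuous fun X : Matrix (m × m) (m × m) ℂ =>
      (Fintype.card (n × m) : ℝ) * √(∑ p, ∑ q, ‖amplify m Φ X p q‖ ^ 2) := by
    refine continuous_const.mul (Real.continuous_sqrt.comp ?_)
    refine continuous_finsetSum _ fun p _ => continuous_finsetSum _ fun q _ => ?_
    exact ((hL.matrix_elem p q).norm).pow 2
  obtain ⟨C, hC⟩ := hK.bddAbove_image hf.continuousOn
  refine ⟨C, ?_⟩
  rintro r ⟨X, hX, rfl⟩
  refine (traceNorm_le _).trans (hC ⟨X, fun p q => ?_, rfl⟩)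
  rw [mem_closedBall_zero_iff]
  have h1 := sum_sq_le_traceNorm_sq X
  rw [hX] at h1
  have h2 : ‖X p q‖ ^ 2 ≤ ∑ i, ∑ j, ‖X i j‖ ^ 2 :=
    (Finset.single_le_sum (f := fun j => ‖X p j‖ ^ 2) (fun j _ => by positivity)
      (Finset.mem_univ q)).trans
    (Finset.single_le_sum (f := fun i => ∑ j, ‖X i j‖ ^ 2) (fun j _ => by positivity)
      (Finset.mem_univ p))
  nlinarith [norm_nonneg (X p q)]

/-- The values in the definition of the diamond norm exist as soon as the input is non-trivial. -/
theorem diamondSet_nonempty [Nonempty m] (Φ : Matrix m m ℂ →ₗ[ℂ] Matrix n n ℂ) :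
    (diamondSet Φ).Nonempty := by
  obtain ⟨i⟩ := ‹Nonempty m›
  refine ⟨_, Matrix.single (i, i) (i, i) 1, ?_, rfl⟩
  have h : (Matrix.single (i, i) (i, i) (1 : ℂ)).PosSemidef := by
    have := Matrix.posSemidef_conjTranspose_mul_self
      (Matrix.single (i, i) (i, i) (1 : ℂ) : Matrix (m × m) (m × m) ℂ)
    simpa using this
  have h2 : CFC.sqrt ((Matrix.single (i, i) (i, i) (1 : ℂ))ᴴ * Matrix.single (i, i) (i, i) 1) =
      Matrix.single (i, i) (i, i) (1 : ℂ) := by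
    rw [h.1.eq]
    exact CFC.sqrt_mul_self _ h.nonneg
  rw [traceNorm, h2]
  simp

theorem isLUB_diamondNorm [Nonempty m] (Φ : Matrix m m ℂ →ₗ[ℂ] Matrix n n ℂ) :
    IsLUB (diamondSet Φ) (diamondNorm Φ) :=
  isLUB_csSup (diamondSet_nonempty Φ) (bddAbove_diamondSet Φ)

/-- The Choi–Jamiołkowski matrix `J(Φ) = ∑ i j, Φ(|i⟩⟨j|) ⊗ |i⟩⟨j|`. -/
def choi (Φ : Matrix m m ℂ →ₗ[ℂ] Matrix n n ℂ) : Matrix (n × m) (n × m) ℂ :=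
  ∑ i, ∑ j, Φ (Matrix.single i j 1) ⊗ₖ (Matrix.single i j 1 : Matrix m m ℂ)

/-- A discriminator of `Φ`: a state `ρ` with
`‖Φ‖_⋄ = ‖(1 ⊗ √ρ) J(Φ) (1 ⊗ √ρ)‖₁`. -/
def IsDiscriminator (Φ : Matrix m m ℂ →ₗ[ℂ] Matrix n n ℂ) (ρ : Matrix m m ℂ) : Prop :=
  IsState ρ ∧
    diamondNorm Φ = traceNorm
      (((1 : Matrix n n ℂ) ⊗ₖ CFC.sqrt ρ) * choi Φ * ((1 : Matrix n n ℂ) ⊗ₖ CFC.sqrt ρ))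

/-- Perfect (single-shot, entanglement-assisted) distinguishability of two channels: for some
ancilla and some input state `σ` on input ⊗ ancilla there is a binary measurement `{E, F}` on
output ⊗ ancilla that identifies the channel which was applied with probability one. -/
def PerfectlyDistinguishable (Φ Ψ : Matrix m m ℂ →ₗ[ℂ] Matrix n n ℂ) : Prop :=
  ∃ (k : ℕ) (σ : Matrix (m × Fin k) (m × Fin k) ℂ) (E F : Matrix (n × Fin k) (n × Fin k) ℂ),
    IsState σ ∧ E.PosSemidef ∧ F.PosSemidef ∧ E + F = 1 ∧
      (E * amplify (Fin k) Φ σ).trace = 1 ∧ (F * amplify (Fin k) Ψ σ).trace = 1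

/-- The measure-and-prepare channel `ρ ↦ ∑ i, tr(ρ T_i) |i⟩⟨i|` of a measurement with effects
`T_i`. -/
def measurementChannel (T : n → Matrix m m ℂ) : Matrix m m ℂ →ₗ[ℂ] Matrix n n ℂ where
  toFun ρ := Matrix.diagonal fun i => (ρ * T i).trace
  map_add' ρ σ := by
    rw [Matrix.diagonal_add]
    simp only [Matrix.add_mul, Matrix.trace_add]
  map_smul' c ρ := by
    rw [RingHom.id_apply, ← Matrix.diagonal_smul]
    congr 1
    ext i
    simp

/-- The von Neumann measurement `𝒫_U` with effects `|u_i⟩⟨u_i|`, `u_i = U|i⟩` being the `i`-th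
column of the unitary matrix `U`. -/
def vonNeumann (U : Matrix.unitaryGroup n ℂ) : Matrix n n ℂ →ₗ[ℂ] Matrix n n ℂ :=
  measurementChannel fun i =>
    Matrix.vecMulVec ((U : Matrix n n ℂ).col i) (star ((U : Matrix n n ℂ).col i))

end Basic

end

end QMeas

namespace QMeas

open scoped Matrix.Norms.L2Operator

/-! ### Duality between the trace norm and the operator norm. -/

section TraceNorm

variable {m n : Type*} [Fintype m] [DecidableEq m] [Fintype n] [DecidableEq n]

/-! The upper bound rests on a phase freedom: a measurement does not see the phases of its basis
vectors, so `U` may be replaced by `U D` with `D` a diagonal unitary. Testing the output against a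
contraction, moving the pinching onto the test matrix and writing the difference as a commutator
with `U D - c` gives `‖𝒫_U - 𝒫_1‖_⋄ ≤ 2 ‖U D - c‖` for every scalar `c`
(`norm_trace_mul_amplify_le`). The ancilla plays no role, so the same estimate also governs perfect
distinguishability.

The lower bounds come from explicit input states. A sandwiched Choi matrix is the channel output on
a purification of `ρ` (`kronecker_mul_choi_mul`), so a state reaching an upper bound is a
discriminator.

If `ω ≤ 1/2`, the bound 2 is trivial, and it is attained as soon as `Uᵀ ρ` has zero diagonal, for
then the two outputs are orthogonal. The weights `|x_i|²` are the sides of a closed polygon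
(`exists_polygon`); its unit side directions supply two vectors whose average projector is such a
`ρ`, hence the rank two.

If `ω = |x_j|² > 1/2`, let `D` be the reflection in `e_j`. Then `U D` is a product of two
reflections: it rotates the plane of `x` and `e_j` by an angle with cosine `c = 2ω - 1` and fixes
the complement. Its distance to `c` is at most the sine `√(1 - c²) < 1`. A pure state in that plane,
at 45 degrees from `x`, attains twice this value.

For pure `ρ` the trace norm is the ℓ¹ distance of two outcome distributions. It equals 2 exactly
when the supports are disjoint, which forces the input to be a multiple of `x` on a set `Δ` of
weight one half. -/

theorem traceNorm_eq_of_sq {A S : Matrix n n ℂ} (hS : S.PosSemidef) (h : S * S = Aᴴ * A) :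
    traceNorm A = S.trace.re := by
  rw [traceNorm, CFC.sqrt_unique h hS.nonneg]

theorem traceNorm_of_posSemidef {A : Matrix n n ℂ} (hA : A.PosSemidef) :
    traceNorm A = A.trace.re :=
  traceNorm_eq_of_sq hA (by rw [hA.1.eq])

theorem traceNorm_nonneg (A : Matrix n n ℂ) : 0 ≤ traceNorm A :=
  (Complex.nonneg_iff.1 (sqrt_gram_posSemidef A).trace_nonneg).1

theorem norm_le_of_posSemidef {A : Matrix n n ℂ} {r : ℝ} (hr : 0 ≤ r)
    (h : ((r ^ 2 : ℝ) • (1 : Matrix n n ℂ) - Aᴴ * A).PosSemidef) : ‖A‖ ≤ r := by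
  have h1 : ‖Aᴴ * A‖ ≤ r ^ 2 := by
    refine (CStarAlgebra.norm_le_iff_le_algebraMap _ (by positivity)
      (Matrix.posSemidef_conjTranspose_mul_self A).nonneg).2 ?_
    rw [Algebra.algebraMap_eq_smul_one]
    exact Matrix.le_iff.2 h
  rw [Matrix.l2_opNorm_conjTranspose_mul_self, ← sq] at h1
  exact (sq_le_sq₀ (norm_nonneg _) hr).1 h1

theorem norm_le_one_of_conjTranspose_mul_self_eq_one {A : Matrix n n ℂ} (h : Aᴴ * A = 1) :
    ‖A‖ ≤ 1 :=
  norm_le_of_posSemidef zero_le_one (by simpa [h] using PosSemidef.zero)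

/-- Hölder's inequality for positive semidefinite matrices. -/
theorem norm_trace_mul_le_of_posSemidef {S : Matrix n n ℂ} (hS : S.PosSemidef)
    (K : Matrix n n ℂ) : ‖(K * S).trace‖ ≤ ‖K‖ * S.trace.re := by
  obtain ⟨R, rfl⟩ := CStarAlgebra.nonneg_iff_eq_star_mul_self.mp hS.nonneg
  simp only [star_eq_conjTranspose]
  have h1 : (K * (Rᴴ * R)).trace =
      ∑ i, inner ℂ (WithLp.toLp 2 (Rᴴ.col i)) (WithLp.toLp 2 (K *ᵥ Rᴴ.col i)) := by
    rw [← Matrix.mul_assoc, Matrix.trace_mul_comm]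
    simp only [Matrix.trace, Matrix.diag, ← Matrix.mul_assoc]
    refine Finset.sum_congr rfl fun i _ => ?_
    rw [Matrix.mul_assoc, EuclideanSpace.inner_toLp_toLp, dotProduct_comm]
    simp [Matrix.mul_apply, dotProduct, mulVec, col]
  have h2 : (Rᴴ * R).trace.re = ∑ i, ‖WithLp.toLp 2 (Rᴴ.col i)‖ ^ 2 := by
    rw [trace_gram]
    refine Finset.sum_congr rfl fun i _ => ?_
    rw [EuclideanSpace.norm_sq_eq]
    simp [col]
  rw [h1, h2, Finset.mul_sum]
  refine (norm_sum_le _ _).trans (Finset.sum_le_sum fun i _ => ?_)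
  refine (norm_inner_le_norm _ _).trans ?_
  have := Matrix.l2_opNorm_mulVec K (WithLp.toLp 2 (Rᴴ.col i))
  calc _ ≤ ‖WithLp.toLp 2 (Rᴴ.col i)‖ * (‖K‖ * ‖WithLp.toLp 2 (Rᴴ.col i)‖) := by gcongr; exact this
    _ = _ := by ring

/-- Polar decomposition with a contraction. -/
theorem exists_polar (A : Matrix n n ℂ) : ∃ W : Matrix n n ℂ, ‖W‖ ≤ 1 ∧
    W * A = CFC.sqrt (Aᴴ * A) ∧ Wᴴ * CFC.sqrt (Aᴴ * A) = A := by
  have hH : (Aᴴ * A).PosSemidef := Matrix.posSemidef_conjTranspose_mul_self A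
  set Q : Matrix n n ℂ := (hH.1.eigenvectorUnitary : Matrix n n ℂ) with hQ
  set e : n → ℝ := hH.1.eigenvalues with he
  have he0 : ∀ i, 0 ≤ e i := hH.eigenvalues_nonneg
  have hQ1 : Qᴴ * Q = 1 := Matrix.mem_unitaryGroup_iff'.1 hH.1.eigenvectorUnitary.2
  have hQ2 : Q * Qᴴ = 1 := Matrix.mem_unitaryGroup_iff.1 hH.1.eigenvectorUnitary.2
  let C (f : n → ℝ) : Matrix n n ℂ := Q * diagonal (fun i => (f i : ℂ)) * Qᴴ
  have hC : ∀ f g, C f * C g = C (f * g) := fun f g => by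
    have : C f * C g = Q * (diagonal (fun i => (f i : ℂ)) * (Qᴴ * Q) *
        diagonal (fun i => (g i : ℂ))) * Qᴴ := by
      simp only [C, Matrix.mul_assoc]
    rw [this, hQ1]
    simp [C]
  have hCH : ∀ f, (C f)ᴴ = C f := fun f => by
    have : (fun i => star ((f i : ℂ))) = fun i => (f i : ℂ) := by ext i; simp
    simp only [C, conjTranspose_mul, conjTranspose_conjTranspose, diagonal_conjTranspose,
      Matrix.mul_assoc]
    congr 2
    exact congrArg diagonal this
  have hC1 : C 1 = 1 := by simp [C, hQ2]
  have hCsub : ∀ f g, C f - C g = C (f - g) := fun f g => by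
    simp only [C, ← Matrix.sub_mul, ← Matrix.mul_sub, diagonal_sub]
    simp
  have hCpos : ∀ f : n → ℝ, (∀ i, 0 ≤ f i) → (C f).PosSemidef := fun f hf =>
    (PosSemidef.diagonal (d := fun i => (f i : ℂ))
      (fun i => by simpa using hf i)).mul_mul_conjTranspose_same Q
  have hAA : Aᴴ * A = C e := by
    have h := hH.1.spectral_theorem
    rw [Unitary.conjStarAlgAut_apply] at h
    exact h
  have hsqrt : CFC.sqrt (Aᴴ * A) = C fun i => √(e i) := by
    refine CFC.sqrt_unique ?_ (hCpos _ fun i => Real.sqrt_nonneg _).nonneg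
    rw [hC, hAA]
    congr 1
    ext i
    exact Real.mul_self_sqrt (he0 i)
  -- This is `|A|⁻¹ Aᴴ` with a pseudo-inverse: since `0⁻¹ = 0`, the kernel of `|A|` contributes
  -- nothing, and `W Wᴴ` is the projection onto the range of `|A|`.
  refine ⟨(C fun i => (√(e i))⁻¹) * Aᴴ, ?_, ?_, ?_⟩
  · rw [← Matrix.l2_opNorm_conjTranspose]
    refine norm_le_of_posSemidef zero_le_one ?_
    rw [conjTranspose_conjTranspose, conjTranspose_mul, conjTranspose_conjTranspose, hCH,
      Matrix.mul_assoc, ← Matrix.mul_assoc Aᴴ, hAA, hC, hC, one_pow, one_smul, ← hC1, hCsub]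
    refine hCpos _ fun i => ?_
    simp only [Pi.sub_apply, Pi.one_apply, Pi.mul_apply, sub_nonneg]
    rcases (he0 i).eq_or_lt with h | h
    · simp [← h]
    · have := Real.sqrt_pos.2 h
      nth_rw 2 [← Real.mul_self_sqrt h.le]
      field_simp
      exact le_rfl
  · rw [Matrix.mul_assoc, hAA, hC, ← hAA, hsqrt]
    congr 1
    ext i
    simp only [Pi.mul_apply]
    rw [inv_mul_eq_div, Real.div_sqrt]
  · rw [hsqrt, conjTranspose_mul, conjTranspose_conjTranspose, hCH, Matrix.mul_assoc, hC]
    rw [← sub_eq_zero, ← Matrix.conjTranspose_mul_self_eq_zero]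
    have h1 : ∀ f, A * C f - A = A * C (f - 1) := fun f => by
      rw [← hCsub, hC1, Matrix.mul_sub, Matrix.mul_one]
    rw [h1, conjTranspose_mul, hCH, Matrix.mul_assoc, ← Matrix.mul_assoc Aᴴ, hAA, hC, hC]
    -- The factor minus one lives only where `e` vanishes, and there `A` vanishes too.
    have h2 : ((fun i => (√(e i))⁻¹) * (fun i => √(e i)) - 1) *
        (e * ((fun i => (√(e i))⁻¹) * (fun i => √(e i)) - 1)) = 0 := by
      ext i
      simp only [Pi.mul_apply, Pi.sub_apply, Pi.one_apply, Pi.zero_apply]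
      rcases (he0 i).eq_or_lt with h | h
      · simp [← h]
      · simp [(Real.sqrt_pos.2 h).ne']
    rw [h2]
    simp [C]

/-- Hölder's inequality for the trace norm and the operator norm. -/
theorem norm_trace_mul_le (K X : Matrix n n ℂ) : ‖(K * X).trace‖ ≤ ‖K‖ * traceNorm X := by
  obtain ⟨W, hW, -, h⟩ := exists_polar X
  have h1 : K * X = (K * Wᴴ) * CFC.sqrt (Xᴴ * X) := by rw [Matrix.mul_assoc, h]
  rw [h1]
  refine (norm_trace_mul_le_of_posSemidef (sqrt_gram_posSemidef X) _).trans ?_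
  refine mul_le_mul_of_nonneg_right ?_ (traceNorm_nonneg X)
  refine (Matrix.l2_opNorm_mul _ _).trans ?_
  rw [Matrix.l2_opNorm_conjTranspose]
  exact mul_le_of_le_one_right (norm_nonneg _) hW

theorem exists_trace_mul_eq_traceNorm (A : Matrix n n ℂ) : ∃ W : Matrix n n ℂ, ‖W‖ ≤ 1 ∧
    (W * A).trace = traceNorm A := by
  obtain ⟨W, hW, h, -⟩ := exists_polar A
  refine ⟨W, hW, ?_⟩
  rw [h, traceNorm]
  have := Complex.nonneg_iff.1 (sqrt_gram_posSemidef A).trace_nonneg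
  exact Complex.ext (by simp) (by simp [← this.2])

end TraceNorm

/-! ### Pinchings and the commutator bound on the diamond norm. -/

section UpperBound

variable {m n k : Type*}

theorem amplify_sub_apply (Φ Ψ : Matrix m m ℂ →ₗ[ℂ] Matrix n n ℂ)
    (X : Matrix (m × k) (m × k) ℂ) :
    amplify k (Φ - Ψ) X = amplify k Φ X - amplify k Ψ X := rfl

/-- The block-diagonal part of a block matrix. -/
def pinch [DecidableEq n] (Y : Matrix (n × k) (n × k) ℂ) : Matrix (n × k) (n × k) ℂ :=
  Matrix.of fun p q => if p.1 = q.1 then Y p q else 0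

variable [Fintype n] [DecidableEq n] [Fintype k] [DecidableEq k]

omit [DecidableEq n] in
theorem kronecker_one_conj_apply (A B : Matrix n n ℂ) (X : Matrix (n × k) (n × k) ℂ)
    (p q : n × k) :
    ((A ⊗ₖ (1 : Matrix k k ℂ)) * X * (B ⊗ₖ (1 : Matrix k k ℂ))) p q =
      (A * (Matrix.of fun i j => X (i, p.2) (j, q.2)) * B) p.1 q.1 := by
  simp [Matrix.mul_apply, Fintype.sum_prod_type, Matrix.one_apply]

omit [Fintype n] [DecidableEq n] [Fintype k] in
theorem sub_kronecker_one (A B : Matrix n n ℂ) :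
    (A - B) ⊗ₖ (1 : Matrix k k ℂ) = A ⊗ₖ (1 : Matrix k k ℂ) - B ⊗ₖ (1 : Matrix k k ℂ) := by
  ext p q
  simp [sub_mul]

theorem vonNeumann_apply (U : Matrix.unitaryGroup n ℂ) (ρ : Matrix n n ℂ) :
    vonNeumann U ρ = diagonal fun i => ((U : Matrix n n ℂ)ᴴ * ρ * (U : Matrix n n ℂ)) i i := by
  change diagonal _ = diagonal _
  congr 1
  ext i
  rw [Matrix.mul_vecMulVec, Matrix.trace_vecMulVec, Matrix.mul_assoc, dotProduct_comm]
  simp [Matrix.mul_apply, dotProduct, mulVec, col]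

theorem amplify_vonNeumann (U : Matrix.unitaryGroup n ℂ) (X : Matrix (n × k) (n × k) ℂ) :
    amplify k (vonNeumann U) X =
      pinch (((U : Matrix n n ℂ) ⊗ₖ (1 : Matrix k k ℂ))ᴴ * X *
        ((U : Matrix n n ℂ) ⊗ₖ (1 : Matrix k k ℂ))) := by
  ext p q
  rw [conjTranspose_kronecker, conjTranspose_one, pinch, of_apply, kronecker_one_conj_apply]
  change vonNeumann U (Matrix.of fun i j => X (i, p.2) (j, q.2)) p.1 q.1 = _
  rw [vonNeumann_apply, diagonal_apply]
  split_ifs with h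
  · rw [h]
  · rfl

omit [DecidableEq k] in
-- Self-adjointness of the pinching for the trace pairing; it transfers the measurement from the
-- state to the test matrix.
theorem trace_mul_pinch (W Y : Matrix (n × k) (n × k) ℂ) :
    (W * pinch Y).trace = (pinch W * Y).trace := by
  simp only [Matrix.trace, Matrix.diag, Matrix.mul_apply, pinch, of_apply]
  refine Finset.sum_congr rfl fun p _ => Finset.sum_congr rfl fun q _ => ?_
  by_cases h : p.1 = q.1
  · simp [h]
  · simp [h, Ne.symm h]

omit [DecidableEq k] in
theorem trace_pinch (Y : Matrix (n × k) (n × k) ℂ) : (pinch Y).trace = Y.trace := by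
  simp [Matrix.trace, pinch]

theorem trace_amplify_vonNeumann (U : Matrix.unitaryGroup n ℂ) (X : Matrix (n × k) (n × k) ℂ) :
    (amplify k (vonNeumann U) X).trace = X.trace := by
  have hU : (U : Matrix n n ℂ) * (U : Matrix n n ℂ)ᴴ = 1 := Matrix.mem_unitaryGroup_iff.1 U.2
  rw [amplify_vonNeumann, trace_pinch, Matrix.trace_mul_comm, ← Matrix.mul_assoc,
    conjTranspose_kronecker, ← Matrix.mul_kronecker_mul, hU]
  simp

theorem pinch_eq_sum (Y : Matrix (n × k) (n × k) ℂ) :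
    pinch Y = ∑ i, (Matrix.single i i (1 : ℂ) ⊗ₖ (1 : Matrix k k ℂ)) * Y *
      (Matrix.single i i (1 : ℂ) ⊗ₖ (1 : Matrix k k ℂ)) := by
  ext p q
  simp only [Matrix.sum_apply, kronecker_one_conj_apply, pinch, of_apply,
    Matrix.single_mul_mul_single]
  simp only [Matrix.single_apply, ite_and, mul_one, one_mul, Finset.sum_ite_eq', Finset.mem_univ,
    if_true]
  obtain ⟨p, a⟩ := p
  obtain ⟨q, b⟩ := q
  by_cases h : p = q
  · subst h
    simp
  · simp [h]

theorem posSemidef_pinch {Y : Matrix (n × k) (n × k) ℂ} (hY : Y.PosSemidef) :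
    (pinch Y).PosSemidef := by
  rw [pinch_eq_sum]
  refine posSemidef_sum _ fun i _ => ?_
  have := hY.mul_mul_conjTranspose_same (Matrix.single i i (1 : ℂ) ⊗ₖ (1 : Matrix k k ℂ))
  simpa [conjTranspose_kronecker] using this

theorem posSemidef_amplify_vonNeumann (U : Matrix.unitaryGroup n ℂ)
    {X : Matrix (n × k) (n × k) ℂ} (hX : X.PosSemidef) :
    (amplify k (vonNeumann U) X).PosSemidef := by
  rw [amplify_vonNeumann]
  exact posSemidef_pinch (hX.conjTranspose_mul_mul_same _)

theorem norm_pinch_le (W : Matrix (n × k) (n × k) ℂ) : ‖pinch W‖ ≤ ‖W‖ := by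
  refine norm_le_of_posSemidef (norm_nonneg _) ?_
  have h0 : ((‖W‖ ^ 2 : ℝ) • (1 : Matrix (n × k) (n × k) ℂ) - Wᴴ * W).PosSemidef := by
    have := CStarAlgebra.star_mul_le_algebraMap_norm_sq (a := W)
    rw [Algebra.algebraMap_eq_smul_one] at this
    exact Matrix.le_iff.1 this
  -- Pythagoras: the diagonal blocks of `Wᴴ W` split into the Gram matrices of the block-diagonal
  -- and the off-diagonal part of `W`.
  have h2 : (‖W‖ ^ 2 : ℝ) • (1 : Matrix (n × k) (n × k) ℂ) - (pinch W)ᴴ * pinch W =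
      pinch ((‖W‖ ^ 2 : ℝ) • (1 : Matrix (n × k) (n × k) ℂ) - Wᴴ * W) +
        pinch ((W - pinch W)ᴴ * (W - pinch W)) := by
    ext p q
    have h3 : ∀ A B : Matrix (n × k) (n × k) ℂ, (Aᴴ * B) p q = ∑ l, star (A l p) * B l q :=
      fun A B => by simp [Matrix.mul_apply]
    simp only [pinch, Matrix.sub_apply, Matrix.add_apply, of_apply, h3, Matrix.smul_apply,
      Matrix.one_apply]
    by_cases h : p.1 = q.1
    · simp only [h, if_true]
      rw [sub_add, ← Finset.sum_sub_distrib]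
      congr 1
      refine Finset.sum_congr rfl fun l _ => ?_
      split_ifs <;> simp
    · have h' : p ≠ q := fun e => h (by rw [e])
      simp only [h, h', if_false, smul_zero, zero_sub, add_zero, neg_eq_zero]
      refine Finset.sum_eq_zero fun l _ => ?_
      by_cases hl : l.1 = p.1
      · simp [hl, h]
      · simp [hl]
  rw [h2]
  exact (posSemidef_pinch h0).add
    (posSemidef_pinch (Matrix.posSemidef_conjTranspose_mul_self _))

/-- The phase freedom of the measurement basis: on each block `D` acts as a scalar. -/
theorem diagonal_kronecker_one_mul_pinch (δ : n → ℂ) (W : Matrix (n × k) (n × k) ℂ) :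
    (diagonal δ ⊗ₖ (1 : Matrix k k ℂ)) * pinch W =
      pinch W * (diagonal δ ⊗ₖ (1 : Matrix k k ℂ)) := by
  rw [← diagonal_one, diagonal_kronecker_diagonal]
  ext p q
  rw [diagonal_mul, mul_diagonal, pinch, of_apply]
  split_ifs with h
  · simp [h, mul_comm]
  · simp

/-- Phrasing the norm bound as positivity of `r² - Aᴴ A` makes it pass to any ancilla, by tensoring
with the identity. -/
theorem norm_kronecker_one_le {A : Matrix n n ℂ} {r : ℝ} (hr : 0 ≤ r)
    (h : ((r ^ 2 : ℝ) • (1 : Matrix n n ℂ) - Aᴴ * A).PosSemidef) :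
    ‖A ⊗ₖ (1 : Matrix k k ℂ)‖ ≤ r := by
  refine norm_le_of_posSemidef hr ?_
  have h1 := h.kronecker (PosSemidef.one (n := k) (R := ℂ))
  rw [conjTranspose_kronecker, ← Matrix.mul_kronecker_mul, conjTranspose_one, Matrix.mul_one,
    ← Matrix.one_kronecker_one (m := n) (n := k), ← Matrix.smul_kronecker, ← sub_kronecker_one]
  exact h1

/-- If `U D` is within `r` of a scalar for a diagonal unitary `D`, then the measurement in the
basis `U` is within `2 r` of the measurement in the standard basis. -/
theorem norm_trace_mul_amplify_le (U : Matrix.unitaryGroup n ℂ) {δ : n → ℂ}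
    (hδ : ∀ i, δ i * star (δ i) = 1) (c : ℂ) {r : ℝ} (hr : 0 ≤ r)
    (h : ((r ^ 2 : ℝ) • (1 : Matrix n n ℂ) -
      ((U : Matrix n n ℂ) * diagonal δ - c • 1)ᴴ *
        ((U : Matrix n n ℂ) * diagonal δ - c • 1)).PosSemidef)
    (W X : Matrix (n × k) (n × k) ℂ) :
    ‖(W * amplify k (vonNeumann U - vonNeumann 1) X).trace‖ ≤
      2 * r * ‖W‖ * traceNorm X := by
  set V : Matrix (n × k) (n × k) ℂ := (U : Matrix n n ℂ) ⊗ₖ (1 : Matrix k k ℂ) with hV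
  set D : Matrix (n × k) (n × k) ℂ := diagonal δ ⊗ₖ (1 : Matrix k k ℂ) with hD
  set M := pinch W with hM
  have hUU : (U : Matrix n n ℂ)ᴴ * (U : Matrix n n ℂ) = 1 := Matrix.mem_unitaryGroup_iff'.1 U.2
  have hUU' : (U : Matrix n n ℂ) * (U : Matrix n n ℂ)ᴴ = 1 := Matrix.mem_unitaryGroup_iff.1 U.2
  have hDM : D * M = M * D := diagonal_kronecker_one_mul_pinch δ W
  have hDD : D * Dᴴ = 1 := by
    rw [hD, conjTranspose_kronecker, ← Matrix.mul_kronecker_mul, diagonal_conjTranspose,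
      diagonal_mul_diagonal]
    have : (fun i => δ i * star δ i) = 1 := funext hδ
    rw [this]
    simp
  have hVV : V * Vᴴ = 1 := by
    rw [hV, conjTranspose_kronecker, ← Matrix.mul_kronecker_mul, hUU']
    simp
  have hZZ : (V * D) * (V * D)ᴴ = 1 := by
    rw [conjTranspose_mul, Matrix.mul_assoc, ← Matrix.mul_assoc D, hDD, Matrix.one_mul, hVV]
  have hZ : ‖V * D - c • 1‖ ≤ r := by
    have : V * D - c • 1 = ((U : Matrix n n ℂ) * diagonal δ - c • 1) ⊗ₖ (1 : Matrix k k ℂ) := by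
      rw [hV, hD, ← Matrix.mul_kronecker_mul, Matrix.mul_one, sub_kronecker_one,
        Matrix.smul_kronecker, Matrix.one_kronecker_one]
    rw [this]
    exact norm_kronecker_one_le hr h
  have hZ1 : ‖(V * D)ᴴ‖ ≤ 1 :=
    norm_le_one_of_conjTranspose_mul_self_eq_one (by rw [conjTranspose_conjTranspose, hZZ])
  -- As `M` commutes with `D`, `V M Vᴴ = (V D) M (V D)ᴴ`; the scalar `c` drops out of the commutator
  -- and is therefore free.
  have hcomm : V * M * Vᴴ - M = ((V * D - c • 1) * M - M * (V * D - c • 1)) * (V * D)ᴴ := by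
    have h1 : (V * D - c • 1) * M - M * (V * D - c • 1) = V * M * D - M * (V * D) := by
      rw [Matrix.sub_mul, Matrix.mul_sub, Matrix.mul_assoc, hDM, ← Matrix.mul_assoc]
      simp
    rw [h1, Matrix.sub_mul, Matrix.mul_assoc M, hZZ, Matrix.mul_one, conjTranspose_mul,
      Matrix.mul_assoc (V * M), ← Matrix.mul_assoc D, hDD, Matrix.one_mul]
  have htr : (W * amplify k (vonNeumann U - vonNeumann 1) X).trace =
      ((V * M * Vᴴ - M) * X).trace := by
    have h1 : amplify k (vonNeumann (1 : Matrix.unitaryGroup n ℂ)) X = pinch X := by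
      rw [amplify_vonNeumann]
      simp
    rw [amplify_sub_apply, h1, amplify_vonNeumann, Matrix.mul_sub, Matrix.trace_sub,
      trace_mul_pinch, trace_mul_pinch, Matrix.sub_mul, Matrix.trace_sub]
    congr 1
    rw [← hV, ← hM, ← Matrix.mul_assoc, Matrix.trace_mul_comm _ V]
    simp only [Matrix.mul_assoc]
  rw [htr]
  refine (norm_trace_mul_le _ _).trans (mul_le_mul_of_nonneg_right ?_ (traceNorm_nonneg X))
  have hMW : ‖M‖ ≤ ‖W‖ := norm_pinch_le W
  rw [hcomm]
  calc _ ≤ ‖(V * D - c • 1) * M - M * (V * D - c • 1)‖ * ‖(V * D)ᴴ‖ := Matrix.l2_opNorm_mul _ _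
    _ ≤ ‖(V * D - c • 1) * M - M * (V * D - c • 1)‖ :=
      mul_le_of_le_one_right (norm_nonneg _) hZ1
    _ ≤ ‖(V * D - c • 1) * M‖ + ‖M * (V * D - c • 1)‖ := norm_sub_le _ _
    _ ≤ ‖V * D - c • 1‖ * ‖M‖ + ‖M‖ * ‖V * D - c • 1‖ :=
      add_le_add (Matrix.l2_opNorm_mul _ _) (Matrix.l2_opNorm_mul _ _)
    _ ≤ r * ‖W‖ + ‖W‖ * r := by gcongr
    _ = _ := by ring

theorem traceNorm_amplify_le (U : Matrix.unitaryGroup n ℂ) {δ : n → ℂ}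
    (hδ : ∀ i, δ i * star (δ i) = 1) (c : ℂ) {r : ℝ} (hr : 0 ≤ r)
    (h : ((r ^ 2 : ℝ) • (1 : Matrix n n ℂ) -
      ((U : Matrix n n ℂ) * diagonal δ - c • 1)ᴴ *
        ((U : Matrix n n ℂ) * diagonal δ - c • 1)).PosSemidef)
    (X : Matrix (n × k) (n × k) ℂ) :
    traceNorm (amplify k (vonNeumann U - vonNeumann 1) X) ≤ 2 * r * traceNorm X := by
  obtain ⟨W, hW, hWt⟩ :=
    exists_trace_mul_eq_traceNorm (amplify k (vonNeumann U - vonNeumann 1) X)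
  have h1 := norm_trace_mul_amplify_le U hδ c hr h W X
  rw [hWt, Complex.norm_real, Real.norm_of_nonneg (traceNorm_nonneg _)] at h1
  refine h1.trans (mul_le_mul_of_nonneg_right ?_ (traceNorm_nonneg X))
  exact mul_le_of_le_one_right (by positivity) hW

theorem diamondNorm_le (U : Matrix.unitaryGroup n ℂ) {δ : n → ℂ} [Nonempty n]
    (hδ : ∀ i, δ i * star (δ i) = 1) (c : ℂ) {r : ℝ} (hr : 0 ≤ r)
    (h : ((r ^ 2 : ℝ) • (1 : Matrix n n ℂ) -
      ((U : Matrix n n ℂ) * diagonal δ - c • 1)ᴴ *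
        ((U : Matrix n n ℂ) * diagonal δ - c • 1)).PosSemidef) :
    diamondNorm (vonNeumann U - vonNeumann 1) ≤ 2 * r := by
  refine (isLUB_diamondNorm _).2 ?_
  rintro s ⟨X, hX, rfl⟩
  simpa [hX] using traceNorm_amplify_le U hδ c hr h X

theorem diamondNorm_le_two (U : Matrix.unitaryGroup n ℂ) [Nonempty n] :
    diamondNorm (vonNeumann U - vonNeumann 1) ≤ 2 := by
  have hUU : (U : Matrix n n ℂ)ᴴ * (U : Matrix n n ℂ) = 1 := Matrix.mem_unitaryGroup_iff'.1 U.2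
  have := diamondNorm_le U (δ := 1) (by simp) 0 zero_le_one
    (by simpa [hUU] using PosSemidef.zero)
  simpa using this

/-- For perfectly distinguishable channels every such bound is at least one. -/
theorem one_le_of_perfectlyDistinguishable (U : Matrix.unitaryGroup n ℂ) {δ : n → ℂ}
    (hδ : ∀ i, δ i * star (δ i) = 1) (c : ℂ) {r : ℝ} (hr : 0 ≤ r)
    (h : ((r ^ 2 : ℝ) • (1 : Matrix n n ℂ) -
      ((U : Matrix n n ℂ) * diagonal δ - c • 1)ᴴ *
        ((U : Matrix n n ℂ) * diagonal δ - c • 1)).PosSemidef)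
    (hpd : PerfectlyDistinguishable (vonNeumann U) (vonNeumann 1)) : 1 ≤ r := by
  obtain ⟨k, σ, E, F, ⟨hσ, hσ1⟩, hE, hF, hEF, h1, h2⟩ := hpd
  have hF' : F = 1 - E := eq_sub_of_add_eq' hEF
  have hnorm : ‖E - F‖ ≤ 1 := by
    refine norm_le_of_posSemidef zero_le_one ?_
    -- Since `F = 1 - E`, the left side is `4 E F`; the sum on the right equals it and is visibly
    -- positive.
    have h3 : (1 ^ 2 : ℝ) • (1 : Matrix (n × Fin k) (n × Fin k) ℂ) - (E - F)ᴴ * (E - F) =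
        (4 : ℝ) • (Eᴴ * F * E + Fᴴ * E * F) := by
      rw [(hE.1.sub hF.1).eq, hE.1.eq, hF.1.eq, hF', one_pow, one_smul,
        show (4 : ℝ) • (E * (1 - E) * E + (1 - E) * E * (1 - E)) =
          (4 : ℕ) • (E * (1 - E) * E + (1 - E) * E * (1 - E)) by
            rw [← Nat.cast_smul_eq_nsmul ℝ]; norm_num]
      noncomm_ring
    rw [h3]
    exact ((hF.conjTranspose_mul_mul_same E).add
      (hE.conjTranspose_mul_mul_same F)).smul (by norm_num)
  have h4 : ((E - F) * amplify (Fin k) (vonNeumann U - vonNeumann 1) σ).trace = 2 := by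
    have h5 := trace_amplify_vonNeumann U σ
    have h6 := trace_amplify_vonNeumann 1 σ
    rw [hσ1] at h5 h6
    rw [hF', Matrix.sub_mul, Matrix.one_mul, Matrix.trace_sub, h6] at h2
    rw [amplify_sub_apply, hF']
    simp only [Matrix.sub_mul, Matrix.mul_sub, Matrix.trace_sub, Matrix.one_mul, h1, h5, h6]
    linear_combination 2 * h2
  have h7 := norm_trace_mul_amplify_le U hδ c hr h (E - F) σ
  rw [h4, traceNorm_of_posSemidef hσ, hσ1] at h7
  simp only [Complex.norm_ofNat, Complex.one_re, mul_one] at h7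
  nlinarith [mul_le_mul_of_nonneg_left hnorm hr]

end UpperBound

/-! ### Choi matrices, discriminators and orthogonal outputs. -/

section Choi

variable {m n : Type*} [Fintype m] [DecidableEq m] [Fintype n] [DecidableEq n]

omit [Fintype n] [DecidableEq n] in
theorem choi_apply (Φ : Matrix m m ℂ →ₗ[ℂ] Matrix n n ℂ) (p q : n × m) :
    choi Φ p q = Φ (Matrix.single p.2 q.2 1) p.1 q.1 := by
  simp only [choi, Matrix.sum_apply, kroneckerMap_apply, Matrix.single_apply, ite_and]
  simp

theorem choi_vonNeumann_apply (U : Matrix.unitaryGroup n ℂ) (p q : n × n) :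
    choi (vonNeumann U) p q =
      if p.1 = q.1 then star ((U : Matrix n n ℂ) p.2 p.1) * (U : Matrix n n ℂ) q.2 p.1 else 0 := by
  rw [choi_apply, vonNeumann_apply, diagonal_apply]
  split_ifs with h
  · simp [Matrix.mul_apply, Matrix.single_apply, ite_and]
  · rfl

/-- The pure (unnormalised) bipartite state with coefficient matrix `R`. -/
def pureState (R : Matrix m m ℂ) : Matrix (m × m) (m × m) ℂ :=
  vecMulVec (fun p => R p.2 p.1) (star fun p => R p.2 p.1)

omit [DecidableEq m] in
theorem posSemidef_pureState (R : Matrix m m ℂ) : (pureState R).PosSemidef :=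
  posSemidef_vecMulVec_self_star _

omit [DecidableEq m] in
theorem trace_pureState (R : Matrix m m ℂ) : (pureState R).trace = (Rᴴ * R).trace := by
  rw [pureState, Matrix.trace_vecMulVec]
  simp [Matrix.trace, Matrix.mul_apply, dotProduct, Fintype.sum_prod_type, mul_comm]

omit [DecidableEq m] in
theorem one_kronecker_conj_apply (A B : Matrix m m ℂ) (X : Matrix (n × m) (n × m) ℂ)
    (p q : n × m) :
    (((1 : Matrix n n ℂ) ⊗ₖ A) * X * ((1 : Matrix n n ℂ) ⊗ₖ B)) p q =
      (A * (Matrix.of fun i j => X (p.1, i) (q.1, j)) * B) p.2 q.2 := by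
  simp [Matrix.mul_apply, Fintype.sum_prod_type, Matrix.one_apply]

/-- The Choi matrix is the output on the unnormalised maximally entangled state, and an operator on
the ancilla commutes with the action of `Φ`. With `R = √ρ` the input is a purification of `ρ`. -/
theorem kronecker_mul_choi_mul (Φ : Matrix m m ℂ →ₗ[ℂ] Matrix n n ℂ) (R : Matrix m m ℂ) :
    ((1 : Matrix n n ℂ) ⊗ₖ R) * choi Φ * ((1 : Matrix n n ℂ) ⊗ₖ Rᴴ) =
      amplify m Φ (pureState R) := by
  ext p q
  have h : (Matrix.of fun i j => pureState R (i, p.2) (j, q.2)) =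
      ∑ c, ∑ e, (R p.2 c * star (R q.2 e)) • Matrix.single c e (1 : ℂ) := by
    ext i j
    simp [pureState, vecMulVec_apply, Matrix.sum_apply, Matrix.single_apply, ite_and]
  change _ = Φ (Matrix.of fun i j => pureState R (i, p.2) (j, q.2)) p.1 q.1
  rw [h]
  rw [one_kronecker_conj_apply]
  simp only [map_sum, map_smul, Matrix.sum_apply, Matrix.smul_apply, Matrix.mul_apply,
    choi_apply, smul_eq_mul, conjTranspose_apply, Finset.sum_mul, of_apply]
  rw [Finset.sum_comm]
  refine Finset.sum_congr rfl fun c _ => Finset.sum_congr rfl fun e _ => ?_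
  ring

theorem sqrt_conjTranspose (ρ : Matrix m m ℂ) : (CFC.sqrt ρ)ᴴ = CFC.sqrt ρ :=
  (CFC.sqrt_nonneg ρ).posSemidef.1.eq

theorem sandwich_choi_eq (Φ : Matrix m m ℂ →ₗ[ℂ] Matrix n n ℂ) (ρ : Matrix m m ℂ) :
    ((1 : Matrix n n ℂ) ⊗ₖ CFC.sqrt ρ) * choi Φ * ((1 : Matrix n n ℂ) ⊗ₖ CFC.sqrt ρ) =
      amplify m Φ (pureState (CFC.sqrt ρ)) := by
  rw [← kronecker_mul_choi_mul, sqrt_conjTranspose]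

theorem isState_pureState_sqrt {ρ : Matrix m m ℂ} (hρ : IsState ρ) :
    IsState (pureState (CFC.sqrt ρ)) := by
  refine ⟨posSemidef_pureState _, ?_⟩
  rw [trace_pureState, sqrt_conjTranspose, CFC.sqrt_mul_sqrt_self _ hρ.1.nonneg, hρ.2]

theorem traceNorm_sandwich_le_diamondNorm (Φ : Matrix m m ℂ →ₗ[ℂ] Matrix n n ℂ)
    {ρ : Matrix m m ℂ} (hρ : IsState ρ) :
    traceNorm (((1 : Matrix n n ℂ) ⊗ₖ CFC.sqrt ρ) * choi Φ * ((1 : Matrix n n ℂ) ⊗ₖ CFC.sqrt ρ)) ≤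
      diamondNorm Φ := by
  have h := isState_pureState_sqrt hρ
  rw [sandwich_choi_eq]
  refine le_csSup (bddAbove_diamondSet Φ) ⟨_, ?_, rfl⟩
  rw [traceNorm_of_posSemidef h.1, h.2, Complex.one_re]

/-- A state whose sandwiched Choi matrix attains an upper bound of the diamond norm is a
discriminator. -/
theorem isDiscriminator_of_le {Φ : Matrix m m ℂ →ₗ[ℂ] Matrix n n ℂ} {ρ : Matrix m m ℂ} {r : ℝ}
    (hρ : IsState ρ) (h : diamondNorm Φ ≤ r)
    (h' : r ≤ traceNorm
      (((1 : Matrix n n ℂ) ⊗ₖ CFC.sqrt ρ) * choi Φ * ((1 : Matrix n n ℂ) ⊗ₖ CFC.sqrt ρ))) :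
    diamondNorm Φ = r ∧ IsDiscriminator Φ ρ := by
  have := traceNorm_sandwich_le_diamondNorm Φ hρ
  exact ⟨by linarith, hρ, by linarith⟩

/-- Orthogonality makes `P + Q` the modulus of `P - Q`: the cross terms vanish in both squares. -/
theorem traceNorm_sub_of_mul_eq_zero {P Q : Matrix n n ℂ} (hP : P.PosSemidef)
    (hQ : Q.PosSemidef) (h : P * Q = 0) : traceNorm (P - Q) = P.trace.re + Q.trace.re := by
  have h' : Q * P = 0 := by
    have := congrArg conjTranspose h
    rwa [conjTranspose_mul, hP.1.eq, hQ.1.eq, conjTranspose_zero] at this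
  rw [traceNorm_eq_of_sq (hP.add hQ), Matrix.trace_add, Complex.add_re]
  rw [(hP.1.sub hQ.1).eq, Matrix.add_mul, Matrix.mul_add, Matrix.mul_add, Matrix.sub_mul,
    Matrix.mul_sub, Matrix.mul_sub, h, h']
  simp

/-- Orthogonal states can be told apart by a binary measurement. -/
theorem exists_measurement_of_mul_eq_zero {P Q : Matrix n n ℂ} (hP : IsState P) (hQ : IsState Q)
    (h : P * Q = 0) : ∃ E F : Matrix n n ℂ, E.PosSemidef ∧ F.PosSemidef ∧ E + F = 1 ∧
      (E * P).trace = 1 ∧ (F * Q).trace = 1 := by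
  have hT := traceNorm_sub_of_mul_eq_zero hP.1 hQ.1 h
  rw [hP.2, hQ.2, Complex.one_re] at hT
  obtain ⟨W, hW, hWT⟩ := exists_trace_mul_eq_traceNorm (P - Q)
  rw [hT] at hWT
  -- The Hermitian part of the optimal test still attains 2 on `P - Q`; the effects will be `(1 ± H)
  -- / 2`.
  set H : Matrix n n ℂ := (1 / 2 : ℝ) • (W + Wᴴ) with hH
  have hHH : H.IsHermitian := by
    rw [IsHermitian, hH, conjTranspose_smul, conjTranspose_add, conjTranspose_conjTranspose,
      add_comm]
    simp
  have hHn : ‖H‖ ≤ 1 := by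
    rw [hH, norm_smul]
    have := norm_add_le W Wᴴ
    rw [Matrix.l2_opNorm_conjTranspose] at this
    norm_num
    linarith
  have hWT' : (Wᴴ * (P - Q)).trace = 2 := by
    rw [← (hP.1.1.sub hQ.1.1).eq, ← conjTranspose_mul, trace_conjTranspose,
      Matrix.trace_mul_comm, hWT]
    simp; norm_num
  have hHT : (H * P).trace - (H * Q).trace = 2 := by
    rw [← Matrix.trace_sub, ← Matrix.mul_sub, hH, Matrix.smul_mul, Matrix.add_mul,
      Matrix.trace_smul, Matrix.trace_add, hWT, hWT', Complex.real_smul]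
    norm_num
  have key : ∀ {R : Matrix n n ℂ}, IsState R → ‖(H * R).trace‖ ≤ 1 := fun {R} hR => by
    have := norm_trace_mul_le_of_posSemidef hR.1 H
    rw [hR.2, Complex.one_re, mul_one] at this
    exact this.trans hHn
  -- Two points of the unit disc that differ by 2 must be the endpoints of the real diameter.
  have hre : ∀ z w : ℂ, ‖z‖ ≤ 1 → ‖w‖ ≤ 1 → z - w = 2 → z = 1 ∧ w = -1 := fun z w hz hw hzw => by
    have h1 := (Complex.re_le_norm z).trans hz
    have h2 := (Complex.abs_re_le_norm w).trans hw
    have h3 : z.re - w.re = 2 := by simpa using congrArg Complex.re hzw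
    have h4 : z.re = 1 := by have := (abs_le.1 h2).1; linarith
    have h5 : z.im = 0 := by
      have := Complex.sq_norm z
      rw [Complex.normSq_apply, h4] at this
      nlinarith [norm_nonneg z, sq_nonneg z.im]
    have h6 : z = 1 := Complex.ext h4 h5
    exact ⟨h6, by rw [h6] at hzw; linear_combination -hzw⟩
  obtain ⟨hHP, hHQ⟩ := hre _ _ (key hP) (key hQ) hHT
  have hle : H ≤ 1 := by
    have h1 : H ≤ algebraMap ℝ (Matrix n n ℂ) ‖H‖ :=
      IsSelfAdjoint.le_algebraMap_norm_self (a := H) hHH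
    refine h1.trans ?_
    rw [← map_one (algebraMap ℝ (Matrix n n ℂ))]
    exact algebraMap_mono _ hHn
  have hge : -1 ≤ H := by
    have h1 : -algebraMap ℝ (Matrix n n ℂ) ‖H‖ ≤ H :=
      IsSelfAdjoint.neg_algebraMap_norm_le_self (a := H) hHH
    refine le_trans (neg_le_neg ?_) h1
    rw [← map_one (algebraMap ℝ (Matrix n n ℂ))]
    exact algebraMap_mono _ hHn
  refine ⟨(1 / 2 : ℝ) • (1 + H), (1 / 2 : ℝ) • (1 - H), ?_, ?_, ?_, ?_, ?_⟩
  · have := (Matrix.le_iff.1 hge).smul (show (0 : ℝ) ≤ 1 / 2 by norm_num)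
    rwa [sub_neg_eq_add, add_comm] at this
  · exact (Matrix.le_iff.1 hle).smul (show (0 : ℝ) ≤ 1 / 2 by norm_num)
  · rw [← smul_add]
    ext i j
    simp
    ring
  · rw [Matrix.smul_mul, Matrix.add_mul, Matrix.trace_smul, Matrix.trace_add, hHP, Matrix.one_mul,
      hP.2, Complex.real_smul]
    norm_num
  · rw [Matrix.smul_mul, Matrix.sub_mul, Matrix.trace_smul, Matrix.trace_sub, hHQ, Matrix.one_mul,
      hQ.2, Complex.real_smul]
    norm_num

section Orthogonal

variable {U : Matrix.unitaryGroup n ℂ} {ρ : Matrix n n ℂ}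

/-- The `i`-th blocks of the Choi matrices are the projectors on the conjugate of the column `u_i`
and on `e_i`. With `ρ` between them, their product carries the scalar `(Uᵀ ρ) i i`. -/
theorem amplify_mul_amplify_eq_zero (hρ : IsState ρ)
    (h : ∀ i, ((U : Matrix n n ℂ)ᵀ * ρ) i i = 0) :
    amplify n (vonNeumann U) (pureState (CFC.sqrt ρ)) *
      amplify n (vonNeumann 1) (pureState (CFC.sqrt ρ)) = 0 := by
  have h1 : choi (vonNeumann U) * ((1 : Matrix n n ℂ) ⊗ₖ ρ) *
      choi (vonNeumann (1 : Matrix.unitaryGroup n ℂ)) = 0 := by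
    ext p q
    have h3 : ∀ l, (choi (vonNeumann U) * ((1 : Matrix n n ℂ) ⊗ₖ ρ)) p l =
        if p.1 = l.1 then star ((U : Matrix n n ℂ) p.2 p.1) * ((U : Matrix n n ℂ)ᵀ * ρ) p.1 l.2
          else 0 := fun l => by
      simp only [Matrix.mul_apply, Fintype.sum_prod_type, choi_vonNeumann_apply,
        kroneckerMap_apply, Matrix.one_apply, transpose_apply, Finset.mul_sum]
      rw [Finset.sum_eq_single p.1 (fun b _ hb => by simp [hb.symm]) (by simp)]
      by_cases h4 : p.1 = l.1
      · simp [h4, mul_assoc]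
      · simp [h4]
    rw [Matrix.mul_apply]
    refine Finset.sum_eq_zero fun l _ => ?_
    rw [h3, choi_vonNeumann_apply]
    by_cases h4 : p.1 = l.1
    · by_cases h5 : l.2 = l.1
      · rw [h5, ← h4, h]
        simp
      · simp [Matrix.one_apply, h5]
    · simp [h4]
  have h2 : ((1 : Matrix n n ℂ) ⊗ₖ CFC.sqrt ρ) * ((1 : Matrix n n ℂ) ⊗ₖ CFC.sqrt ρ) =
      (1 : Matrix n n ℂ) ⊗ₖ ρ := by
    rw [← Matrix.mul_kronecker_mul, CFC.sqrt_mul_sqrt_self _ hρ.1.nonneg, Matrix.one_mul]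
  rw [← sandwich_choi_eq, ← sandwich_choi_eq]
  set S := (1 : Matrix n n ℂ) ⊗ₖ CFC.sqrt ρ
  calc _ = S * (choi (vonNeumann U) * (S * S) *
        choi (vonNeumann (1 : Matrix.unitaryGroup n ℂ))) * S := by simp only [Matrix.mul_assoc]
    _ = 0 := by rw [h2, h1]; simp

theorem isState_amplify_vonNeumann (U : Matrix.unitaryGroup n ℂ) {k : Type*} [Fintype k]
    [DecidableEq k] {σ : Matrix (n × k) (n × k) ℂ} (hσ : IsState σ) :
    IsState (amplify k (vonNeumann U) σ) :=
  ⟨posSemidef_amplify_vonNeumann U hσ.1, by rw [trace_amplify_vonNeumann, hσ.2]⟩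

theorem traceNorm_sandwich_eq_two (hρ : IsState ρ)
    (h : ∀ i, ((U : Matrix n n ℂ)ᵀ * ρ) i i = 0) :
    traceNorm (((1 : Matrix n n ℂ) ⊗ₖ CFC.sqrt ρ) * choi (vonNeumann U - vonNeumann 1) *
      ((1 : Matrix n n ℂ) ⊗ₖ CFC.sqrt ρ)) = 2 := by
  have hσ := isState_pureState_sqrt hρ
  have hP := isState_amplify_vonNeumann U hσ
  have hQ := isState_amplify_vonNeumann 1 hσ
  rw [sandwich_choi_eq, amplify_sub_apply,
    traceNorm_sub_of_mul_eq_zero hP.1 hQ.1 (amplify_mul_amplify_eq_zero hρ h), hP.2, hQ.2]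
  norm_num

end Orthogonal

theorem perfectlyDistinguishable_of_state {d : ℕ} {U : Matrix.unitaryGroup (Fin d) ℂ}
    {ρ : Matrix (Fin d) (Fin d) ℂ} (hρ : IsState ρ)
    (h : ∀ i, ((U : Matrix (Fin d) (Fin d) ℂ)ᵀ * ρ) i i = 0) :
    PerfectlyDistinguishable (vonNeumann U) (vonNeumann 1) := by
  have hσ := isState_pureState_sqrt hρ
  obtain ⟨E, F, hE, hF, hEF, h1, h2⟩ := exists_measurement_of_mul_eq_zero
    (isState_amplify_vonNeumann U hσ) (isState_amplify_vonNeumann 1 hσ)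
    (amplify_mul_amplify_eq_zero hρ h)
  exact ⟨d, _, E, F, hσ, hE, hF, hEF, h1, h2⟩

end Choi

/-! ### Rank-one discriminators and outcome distributions. -/

section RankOne

variable {m n : Type*} [Fintype m] [DecidableEq m] [Fintype n] [DecidableEq n]

omit [DecidableEq n] in
theorem vecMulVec_star_mul_self {φ : n → ℂ} (hφ : ∑ i, ‖φ i‖ ^ 2 = 1) :
    vecMulVec φ (star φ) * vecMulVec φ (star φ) = vecMulVec φ (star φ) := by
  have h : star φ ⬝ᵥ φ = 1 := by
    simp only [dotProduct, Pi.star_apply, Complex.star_def, Complex.conj_mul']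
    exact_mod_cast hφ
  rw [vecMulVec_mul_vecMulVec, h]
  simp

omit [DecidableEq n] in
theorem isState_vecMulVec {φ : n → ℂ} (hφ : ∑ i, ‖φ i‖ ^ 2 = 1) :
    IsState (vecMulVec φ (star φ)) := by
  refine ⟨posSemidef_vecMulVec_self_star _, ?_⟩
  rw [trace_vecMulVec]
  simp only [dotProduct, Pi.star_apply, Complex.star_def, Complex.mul_conj']
  exact_mod_cast hφ

theorem sqrt_vecMulVec {φ : n → ℂ} (hφ : ∑ i, ‖φ i‖ ^ 2 = 1) :
    CFC.sqrt (vecMulVec φ (star φ)) = vecMulVec φ (star φ) :=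
  CFC.sqrt_unique (vecMulVec_star_mul_self hφ) (posSemidef_vecMulVec_self_star φ).nonneg

/-- A state of rank one is a pure state. -/
theorem IsState.exists_eq_vecMulVec {ρ : Matrix n n ℂ} (hρ : IsState ρ) (h : ρ.rank = 1) :
    ∃ φ : n → ℂ, ∑ i, ‖φ i‖ ^ 2 = 1 ∧ ρ = vecMulVec φ (star φ) := by
  have hH := hρ.1.1
  have hcard := hH.rank_eq_card_non_zero_eigs
  rw [h, eq_comm, Fintype.card_eq_one_iff] at hcard
  obtain ⟨⟨j, hj⟩, huniq⟩ := hcard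
  have h0 : ∀ i, i ≠ j → hH.eigenvalues i = 0 := fun i hi => by
    by_contra hne
    exact hi (congrArg Subtype.val (huniq ⟨i, hne⟩))
  have hsum := hH.trace_eq_sum_eigenvalues
  rw [hρ.2, Finset.sum_eq_single j (fun i _ hi => by rw [h0 i hi]; simp) (by simp)] at hsum
  have h1 : hH.eigenvalues j = 1 := Complex.ofReal_injective hsum.symm
  set Q : Matrix n n ℂ := (hH.eigenvectorUnitary : Matrix n n ℂ) with hQ
  have hQ1 : Qᴴ * Q = 1 := Matrix.mem_unitaryGroup_iff'.1 hH.eigenvectorUnitary.2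
  refine ⟨Q.col j, ?_, ?_⟩
  · have := congrFun (congrFun hQ1 j) j
    rw [Matrix.mul_apply, Matrix.one_apply_eq] at this
    simp only [conjTranspose_apply, Complex.star_def, Complex.conj_mul'] at this
    simp only [col_apply]
    exact_mod_cast this
  · have h2 := hH.spectral_theorem
    rw [Unitary.conjStarAlgAut_apply] at h2
    rw [h2]
    ext a b
    rw [Matrix.mul_apply, Finset.sum_eq_single j]
    · simp [h1, vecMulVec_apply, hQ, star_apply]
    · intro i _ hi
      simp [h0 i hi]
    · simp

omit [Fintype n] [DecidableEq n] in
theorem pureState_vecMulVec (φ : n → ℂ) :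
    pureState (vecMulVec φ (star φ)) =
      vecMulVec (star φ) φ ⊗ₖ vecMulVec φ (star φ) := by
  ext p q
  simp only [pureState, vecMulVec_apply, kroneckerMap_apply, Pi.star_apply, star_mul', star_star]
  ring

theorem traceNorm_diagonal_kronecker {ρ : Matrix m m ℂ} (hρ : IsState ρ) (δ : n → ℝ) :
    traceNorm ((diagonal fun i => (δ i : ℂ)) ⊗ₖ ρ) = ∑ i, |δ i| := by
  have hpos : ((diagonal fun i => ((|δ i| : ℝ) : ℂ)) ⊗ₖ ρ).PosSemidef :=
    (PosSemidef.diagonal (fun i => by simp)).kronecker hρ.1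
  rw [traceNorm_eq_of_sq hpos, trace_kronecker, hρ.2, mul_one, trace_diagonal]
  · simp
  · rw [conjTranspose_kronecker, hρ.1.1.eq, ← Matrix.mul_kronecker_mul, ← Matrix.mul_kronecker_mul,
      diagonal_conjTranspose, diagonal_mul_diagonal, diagonal_mul_diagonal]
    congr 2
    ext i
    simp only [Pi.star_apply, Complex.star_def, Complex.conj_ofReal]
    norm_cast
    exact abs_mul_abs_self _

theorem vonNeumann_vecMulVec (U : Matrix.unitaryGroup n ℂ) (ψ : n → ℂ) :
    vonNeumann U (vecMulVec ψ (star ψ)) =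
      diagonal fun i => ((‖((U : Matrix n n ℂ)ᴴ *ᵥ ψ) i‖ ^ 2 : ℝ) : ℂ) := by
  rw [vonNeumann_apply]
  congr 1
  ext i
  rw [Matrix.mul_vecMulVec, Matrix.vecMulVec_mul, vecMulVec_apply, Complex.ofReal_pow,
    ← Complex.mul_conj']
  congr 1
  simp [vecMul, mulVec, dotProduct, mul_comm]

/-- For pure `ρ` the purification is the product of `star φ` and `φ`, so the ancilla is idle and
only the outcome probabilities of `star φ` in the two bases remain. -/
theorem traceNorm_sandwich_vecMulVec (U : Matrix.unitaryGroup n ℂ) {φ : n → ℂ}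
    (hφ : ∑ i, ‖φ i‖ ^ 2 = 1) :
    traceNorm (((1 : Matrix n n ℂ) ⊗ₖ CFC.sqrt (vecMulVec φ (star φ))) *
      choi (vonNeumann U - vonNeumann 1) *
      ((1 : Matrix n n ℂ) ⊗ₖ CFC.sqrt (vecMulVec φ (star φ)))) =
      ∑ i, |‖((U : Matrix n n ℂ)ᴴ *ᵥ star φ) i‖ ^ 2 - ‖φ i‖ ^ 2| := by
  have h1 := vonNeumann_vecMulVec U (star φ)
  have h2 := vonNeumann_vecMulVec 1 (star φ)
  rw [star_star] at h1 h2
  have h3 : (vonNeumann U - vonNeumann 1 : Matrix n n ℂ →ₗ[ℂ] Matrix n n ℂ)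
      (vecMulVec (star φ) φ) = diagonal fun i =>
      ((‖((U : Matrix n n ℂ)ᴴ *ᵥ star φ) i‖ ^ 2 - ‖φ i‖ ^ 2 : ℝ) : ℂ) := by
    rw [LinearMap.sub_apply, h1, h2, diagonal_sub]
    congr 1
    ext i
    simp
  rw [sandwich_choi_eq, sqrt_vecMulVec hφ, pureState_vecMulVec, amplify_kronecker, h3,
    traceNorm_diagonal_kronecker (isState_vecMulVec hφ)]

theorem sum_norm_sq_unitary_mulVec (U : Matrix.unitaryGroup n ℂ) (ψ : n → ℂ) :
    ∑ i, ‖((U : Matrix n n ℂ)ᴴ *ᵥ ψ) i‖ ^ 2 = ∑ i, ‖ψ i‖ ^ 2 := by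
  have hU : (U : Matrix n n ℂ) * (U : Matrix n n ℂ)ᴴ = 1 := Matrix.mem_unitaryGroup_iff.1 U.2
  have key : ∀ v : n → ℂ, ((∑ i, ‖v i‖ ^ 2 : ℝ) : ℂ) = star v ⬝ᵥ v := fun v => by
    simp [dotProduct, Complex.conj_mul']
  have : ((∑ i, ‖((U : Matrix n n ℂ)ᴴ *ᵥ ψ) i‖ ^ 2 : ℝ) : ℂ) = ((∑ i, ‖ψ i‖ ^ 2 : ℝ) : ℂ) := by
    rw [key, key, star_mulVec, conjTranspose_conjTranspose, ← dotProduct_mulVec, mulVec_mulVec, hU,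
      one_mulVec]
  exact_mod_cast this

end RankOne

/-! ### Closing polygons with prescribed side lengths. -/

section Polygon

/-- Three lengths satisfying the triangle inequalities are the sides of a triangle. -/
theorem exists_triangle {α β γ : ℝ} (hα : 0 ≤ α) (hβ : 0 ≤ β) (hγ : 0 ≤ γ)
    (h1 : α ≤ β + γ) (h2 : β ≤ α + γ) (h3 : γ ≤ α + β) :
    ∃ u v w : ℂ, ‖u‖ = 1 ∧ ‖v‖ = 1 ∧ ‖w‖ = 1 ∧ α * u + β * v + γ * w = 0 := by
  obtain ⟨v, hv, hvn⟩ : ∃ v : ℂ, ‖v‖ = 1 ∧ ‖(β * v + γ : ℂ)‖ = α := by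
    -- Opening the angle between the sides `β` and `γ` moves the third side continuously from `β +
    -- γ` to `|γ - β|`, passing through `α`.
    have hcont : ContinuousOn (fun t : ℝ => ‖(β * Complex.exp (t * Complex.I) + γ : ℂ)‖)
        (Set.Icc 0 Real.pi) := by fun_prop
    have hmem : α ∈ Set.Icc ‖(β * Complex.exp ((Real.pi : ℝ) * Complex.I) + γ : ℂ)‖
        ‖(β * Complex.exp ((0 : ℝ) * Complex.I) + γ : ℂ)‖ := by
      have e1 : (β * Complex.exp ((Real.pi : ℝ) * Complex.I) + γ : ℂ) = ((γ - β : ℝ) : ℂ) := by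
        rw [Complex.exp_pi_mul_I]; push_cast; ring
      have e2 : (β * Complex.exp ((0 : ℝ) * Complex.I) + γ : ℂ) = ((β + γ : ℝ) : ℂ) := by
        simp
      rw [e1, e2, Complex.norm_real, Complex.norm_real,
        Real.norm_of_nonneg (add_nonneg hβ hγ)]
      exact ⟨abs_le.2 ⟨by linarith, by linarith⟩, h1⟩
    obtain ⟨t, -, ht⟩ := intermediate_value_Icc' Real.pi_pos.le hcont hmem
    exact ⟨_, Complex.norm_exp_ofReal_mul_I t, ht⟩
  rcases hα.eq_or_lt with h | h
  · refine ⟨1, v, 1, by simp, hv, by simp, ?_⟩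
    rw [← h, norm_eq_zero] at hvn
    rw [← h, Complex.ofReal_zero]
    linear_combination hvn
  · refine ⟨-(β * v + γ) / α, v, 1, ?_, hv, by simp, ?_⟩
    · rw [norm_div, norm_neg, hvn, Complex.norm_real, Real.norm_of_nonneg hα, div_self h.ne']
    · have : (α : ℂ) ≠ 0 := by exact_mod_cast h.ne'
      field_simp
      ring

/-- Nonnegative lengths, none exceeding the sum of the others, close up to a polygon. -/
theorem exists_polygon {n : Type*} [Fintype n] [DecidableEq n] {p : n → ℝ} (hp : ∀ i, 0 ≤ p i)
    (hsum : ∑ i, p i = 1) (hmax : ∀ i, p i ≤ 1 / 2) :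
    ∃ c : n → ℂ, (∀ i, ‖c i‖ = 1) ∧ ∑ i, (p i : ℂ) * c i = 0 := by
  -- Take a heaviest `S` of weight at most one half. Adding some `j` of positive weight overshoots,
  -- so `S`, `{j}` and the rest each weigh at most one half: the polygon collapses to a triangle.
  obtain ⟨S, hS, hSmax⟩ := Finset.exists_max_image
    (Finset.univ.filter fun S : Finset n => ∑ i ∈ S, p i ≤ 1 / 2) (fun S => ∑ i ∈ S, p i)
    ⟨∅, by simp⟩
  simp only [Finset.mem_filter, Finset.mem_univ, true_and] at hS hSmax
  have hSc := Finset.sum_add_sum_compl S p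
  rw [hsum] at hSc
  obtain ⟨j, hjS, hj⟩ : ∃ j ∈ Sᶜ, 0 < p j := by
    by_contra! hcon
    have := Finset.sum_nonpos hcon
    linarith
  have hins : 1 / 2 < ∑ i ∈ S, p i + p j := by
    by_contra! hcon
    have h1 : ∑ i ∈ insert j S, p i = ∑ i ∈ S, p i + p j := by
      rw [Finset.sum_insert (Finset.mem_compl.1 hjS), add_comm]
    have := hSmax (insert j S) (by rw [h1]; exact hcon)
    linarith
  have hT := Finset.add_sum_erase _ p hjS
  set T := Sᶜ.erase j
  have hT0 : 0 ≤ ∑ i ∈ T, p i := Finset.sum_nonneg fun i _ => hp i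
  have hS0 : 0 ≤ ∑ i ∈ S, p i := Finset.sum_nonneg fun i _ => hp i
  have hj1 := hmax j
  obtain ⟨u, v, w, hu, hv, hw, huvw⟩ := exists_triangle (hp j) hS0 hT0
    (by linarith) (by linarith) (by linarith)
  refine ⟨fun i => if i ∈ S then v else if i = j then u else w, fun i => ?_, ?_⟩
  · dsimp only
    split_ifs <;> assumption
  · rw [← Finset.sum_add_sum_compl S, ← Finset.add_sum_erase _ _ hjS,
      Finset.sum_congr rfl (g := fun i => (p i : ℂ) * v) (fun i hi => by simp [hi]),
      Finset.sum_congr (s₁ := Sᶜ.erase j) rfl (g := fun i => (p i : ℂ) * w) (fun i hi => by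
        rw [Finset.mem_erase, Finset.mem_compl] at hi
        simp [hi.1, hi.2]), ← Finset.sum_mul, ← Finset.sum_mul]
    rw [Finset.mem_compl] at hjS
    simp only [hjS, if_false, if_true]
    push_cast at huvw
    linear_combination huvw

end Polygon

/-! ### Optimal states and bounds for the reflection in `x`. -/

section Reflection

variable {n : Type*} [Fintype n] [DecidableEq n] {x : n → ℂ} {U : Matrix.unitaryGroup n ℂ}

theorem reflection_conjTranspose_mulVec
    (hU : (U : Matrix n n ℂ) = 1 - (2 : ℂ) • vecMulVec x (star x)) (ψ : n → ℂ) (i : n) :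
    ((U : Matrix n n ℂ)ᴴ *ᵥ ψ) i = ψ i - 2 * (∑ a, star (x a) * ψ a) * x i := by
  have h : (U : Matrix n n ℂ)ᴴ = 1 - (2 : ℂ) • vecMulVec x (star x) := by
    rw [hU, conjTranspose_sub, conjTranspose_smul, conjTranspose_vecMulVec]
    simp
  rw [h, sub_mulVec, smul_mulVec, vecMulVec_mulVec]
  simp [dotProduct, mul_comm, mul_left_comm]

omit [DecidableEq n] in
theorem rank_vecMulVec_add_vecMulVec_le (a b c e : n → ℂ) :
    (vecMulVec a b + vecMulVec c e).rank ≤ 2 := by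
  have h : vecMulVec a b + vecMulVec c e =
      (Matrix.of fun i l => ![a i, c i] l) * (Matrix.of fun l j => ![b j, e j] l) := by
    ext i j
    simp [Matrix.mul_apply, Fin.sum_univ_two, vecMulVec_apply]
  rw [h]
  exact (rank_mul_le_left _ _).trans (rank_le_card_width _)

/-- When no weight exceeds one half, some state of rank at most two has orthogonal outputs. -/
theorem exists_state_rank_le_two (hx : ∑ i, ‖x i‖ ^ 2 = 1)
    (hU : (U : Matrix n n ℂ) = 1 - (2 : ℂ) • vecMulVec x (star x))
    (hmax : ∀ i, ‖x i‖ ^ 2 ≤ 1 / 2) :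
    ∃ ρ : Matrix n n ℂ, IsState ρ ∧ ρ.rank ≤ 2 ∧ ∀ i, ((U : Matrix n n ℂ)ᵀ * ρ) i i = 0 := by
  obtain ⟨c, hc, hc0⟩ := exists_polygon (fun i => sq_nonneg ‖x i‖) hx hmax
  have hre : ∑ i, ‖x i‖ ^ 2 * (c i).re = 0 := by
    simpa only [Complex.re_sum, Complex.re_ofReal_mul, Complex.zero_re] using congrArg Complex.re hc0
  have him : ∑ i, ‖x i‖ ^ 2 * (c i).im = 0 := by
    simpa only [Complex.im_sum, Complex.im_ofReal_mul, Complex.zero_im] using congrArg Complex.im hc0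
  have hc1 : ∀ i, (c i).re ^ 2 + (c i).im ^ 2 = 1 := fun i => by
    have := Complex.sq_norm (c i)
    rw [hc, Complex.normSq_apply] at this
    linarith
  -- Chosen so that `ρ a i = star (x a) * x i * Re ((1 + c a) * star (1 + c i)) / 2`. As `|c i| =
  -- 1`, the diagonal is `|x i|² (1 + Re c i)`, and the closing condition gives trace one.
  let f : n → ℂ := fun i => star (x i) * ((1 + (c i).re : ℝ) : ℂ)
  let g : n → ℂ := fun i => star (x i) * ((c i).im : ℂ)
  have hxx : ∀ i, x i * star (x i) = ((‖x i‖ ^ 2 : ℝ) : ℂ) := fun i => by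
    rw [Complex.star_def, Complex.mul_conj', Complex.ofReal_pow]
  have happ : ∀ a i, ((1 / 2 : ℝ) • (vecMulVec f (star f) + vecMulVec g (star g))) a i =
      star (x a) * x i *
        (((1 + (c a).re) * (1 + (c i).re) + (c a).im * (c i).im) / 2 : ℝ) := fun a i => by
    simp only [Matrix.smul_apply, Matrix.add_apply, vecMulVec_apply, f, g, Pi.star_apply,
      star_mul', Complex.star_def, Complex.conj_ofReal, Complex.conj_conj, Complex.real_smul]
    push_cast
    ring
  refine ⟨(1 / 2 : ℝ) • (vecMulVec f (star f) + vecMulVec g (star g)), ⟨?_, ?_⟩, ?_, ?_⟩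
  · exact ((posSemidef_vecMulVec_self_star f).add (posSemidef_vecMulVec_self_star g)).smul
      (by norm_num)
  · have h1 : ∀ i, ((1 / 2 : ℝ) • (vecMulVec f (star f) + vecMulVec g (star g))) i i =
        ((‖x i‖ ^ 2 + ‖x i‖ ^ 2 * (c i).re : ℝ) : ℂ) := fun i => by
      rw [happ, mul_comm (star _), hxx, ← Complex.ofReal_mul]
      congr 1
      linear_combination ‖x i‖ ^ 2 / 2 * hc1 i
    simp only [Matrix.trace, Matrix.diag, h1]
    rw [← Complex.ofReal_sum, Finset.sum_add_distrib, hx, hre]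
    simp
  · rw [smul_add, ← smul_vecMulVec, ← smul_vecMulVec]
    exact rank_vecMulVec_add_vecMulVec_le _ _ _ _
  -- Closing the polygon replaces the average of `1 + c a` with weights `|x a|²` by 1, so the
  -- reflection term equals `|x i|² (1 + Re c i)`, the diagonal entry it must cancel.
  · intro i
    have h1 : ∀ a, (U : Matrix n n ℂ)ᵀ i a = (if a = i then 1 else 0) - 2 * x a * star (x i) :=
      fun a => by
        rw [hU]
        simp [vecMulVec_apply, Matrix.one_apply, mul_assoc]
    simp only [Matrix.mul_apply, happ, h1, sub_mul, ite_mul, one_mul, zero_mul,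
      Finset.sum_sub_distrib, Finset.sum_ite_eq', Finset.mem_univ, if_true]
    have h2 : ∀ a, 2 * x a * star (x i) * (star (x a) * x i *
        (((1 + (c a).re) * (1 + (c i).re) + (c a).im * (c i).im) / 2 : ℝ)) =
        ((‖x i‖ ^ 2 * ((1 + (c i).re) * (‖x a‖ ^ 2 + ‖x a‖ ^ 2 * (c a).re) +
          (c i).im * (‖x a‖ ^ 2 * (c a).im)) : ℝ) : ℂ) := fun a => by
      have : 2 * x a * star (x i) * (star (x a) * x i *
        (((1 + (c a).re) * (1 + (c i).re) + (c a).im * (c i).im) / 2 : ℝ)) =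
          (x a * star (x a)) * (x i * star (x i)) * (2 *
        (((1 + (c a).re) * (1 + (c i).re) + (c a).im * (c i).im) / 2 : ℝ)) := by ring
      rw [this, hxx, hxx]
      push_cast
      ring
    simp only [h2]
    rw [← Complex.ofReal_sum, mul_comm (star _), hxx, ← Complex.ofReal_mul, ← Complex.ofReal_sub,
      ← Finset.mul_sum, Finset.sum_add_distrib, ← Finset.mul_sum, ← Finset.mul_sum,
      Finset.sum_add_distrib, hx, hre, him, Complex.ofReal_eq_zero]
    linear_combination ‖x i‖ ^ 2 / 2 * hc1 i

/-- The product of the reflections in `x` and in the basis vector `e_j` is a rotation by an angle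
with cosine `2 |x_j|² - 1`. -/
theorem posSemidef_reflection_mul_reflection (hx : ∑ i, ‖x i‖ ^ 2 = 1)
    (hU : (U : Matrix n n ℂ) = 1 - (2 : ℂ) • vecMulVec x (star x)) (j : n)
    (hj : 1 / 2 < ‖x j‖ ^ 2) :
    ((√(1 - 4 * (‖x j‖ ^ 2 - 1 / 2) ^ 2) ^ 2 : ℝ) • (1 : Matrix n n ℂ) -
      ((U : Matrix n n ℂ) * diagonal (fun i => if i = j then -1 else 1) -
          ((2 * ‖x j‖ ^ 2 - 1 : ℝ) : ℂ) • 1)ᴴ *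
        ((U : Matrix n n ℂ) * diagonal (fun i => if i = j then -1 else 1) -
          ((2 * ‖x j‖ ^ 2 - 1 : ℝ) : ℂ) • 1)).PosSemidef := by
  set P : Matrix n n ℂ := vecMulVec x (star x) with hP
  set E : Matrix n n ℂ := Matrix.single j j 1 with hE
  set w : ℝ := ‖x j‖ ^ 2 with hw
  have hw1 : w ≤ 1 := by
    rw [← hx]
    exact Finset.single_le_sum (f := fun i => ‖x i‖ ^ 2) (fun i _ => sq_nonneg _)
      (Finset.mem_univ j)
  have hD : (diagonal (fun i => if i = j then -1 else 1) : Matrix n n ℂ) = 1 - (2 : ℂ) • E := by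
    ext a b
    by_cases hab : a = b
    · subst hab
      by_cases ha : a = j
      · subst ha
        simp [hE]
        norm_num
      · simp [hE, ha, Ne.symm ha]
    · have : ¬ (j = a ∧ j = b) := fun h => hab (h.1.symm.trans h.2)
      simp [hE, hab, this]
  have hEE : E * E = E := by simp [hE]
  have hPP : P * P = P := vecMulVec_star_mul_self hx
  have hEH : Eᴴ = E := by simp [hE]
  have hPH : Pᴴ = P := (posSemidef_vecMulVec_self_star x).1
  have hPEP : P * E * P = (w : ℂ) • P := by
    ext a b
    rw [Matrix.mul_apply]
    simp only [hP, hE, vecMulVec_apply, Matrix.mul_apply, Matrix.single_apply, ite_and,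
      Matrix.smul_apply, smul_eq_mul]
    have : (w : ℂ) = star (x j) * x j := by
      rw [hw, Complex.star_def, Complex.conj_mul', Complex.ofReal_pow]
    rw [this]
    simp
    ring
  obtain ⟨F, hF⟩ : ∃ F : Matrix n n ℂ, F = 1 - E := ⟨_, rfl⟩
  have hFF : F * F = F := by
    rw [hF, Matrix.sub_mul, Matrix.mul_sub E, hEE]
    simp
  have hFH : Fᴴ = F := by rw [hF, conjTranspose_sub, conjTranspose_one, hEH]
  have hPFP : P * F * P = ((1 - w : ℝ) : ℂ) • P := by
    rw [hF, Matrix.mul_sub, Matrix.sub_mul, Matrix.mul_one, hPP, hPEP]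
    push_cast
    rw [sub_smul, one_smul]
  obtain ⟨N, hN⟩ : ∃ N : Matrix n n ℂ, N = F * P * F := ⟨_, rfl⟩
  have hFN : F * N = N := by rw [hN, ← Matrix.mul_assoc, ← Matrix.mul_assoc, hFF]
  have hNF : N * F = N := by rw [hN, Matrix.mul_assoc, hFF]
  have hNN : N * N = ((1 - w : ℝ) : ℂ) • N := by
    calc N * N = F * P * (F * F) * P * F := by rw [hN]; simp only [Matrix.mul_assoc]
      _ = F * (P * F * P) * F := by rw [hFF]; simp only [Matrix.mul_assoc]
      _ = _ := by rw [hPFP, Matrix.mul_smul, Matrix.smul_mul, hN]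
  have hNH : Nᴴ = N := by
    rw [hN, conjTranspose_mul, conjTranspose_mul, hFH, hPH, Matrix.mul_assoc]
  -- `H` is `1 - w` times the projection onto the complement of the plane of `x` and `e_j`; it is
  -- zero when `w = 1`.
  obtain ⟨H, hH⟩ : ∃ H : Matrix n n ℂ, H = ((1 - w : ℝ) : ℂ) • F - N := ⟨_, rfl⟩
  have hHH : Hᴴ = H := by
    rw [hH, conjTranspose_sub, conjTranspose_smul, hNH, hFH, Complex.star_def, Complex.conj_ofReal]
  have hH2 : Hᴴ * H = ((1 - w : ℝ) : ℂ) • H := by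
    rw [hHH, hH, Matrix.sub_mul, Matrix.mul_sub, Matrix.mul_sub, hNN, Matrix.smul_mul,
      Matrix.smul_mul, Matrix.mul_smul, Matrix.mul_smul, hFF, hFN, hNF, sub_self, sub_zero,
      smul_sub]
  have hHpos : H.PosSemidef := by
    rcases hw1.eq_or_lt with h | h
    · have : H = 0 := by
        rw [← Matrix.conjTranspose_mul_self_eq_zero, hH2, h]
        simp
      rw [this]
      exact PosSemidef.zero
    · have h1 := (Matrix.posSemidef_conjTranspose_mul_self H).smul
        (inv_nonneg.2 (sub_nonneg.2 hw1))
      rw [hH2, Complex.coe_smul, smul_smul, inv_mul_cancel₀ (sub_pos.2 h).ne', one_smul] at h1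
      exact h1
  -- With `R = U D` unitary, `c = 2 w - 1` and `r² = 1 - c²`, the left side is `c (R + Rᴴ - 2 c)`.
  -- It vanishes on the plane; on the complement, where `R = 1`, its sign is that of `c`, whence the
  -- need for `w > 1/2`.
  have hfin : (√(1 - 4 * (w - 1 / 2) ^ 2) ^ 2 : ℝ) • (1 : Matrix n n ℂ) -
      ((U : Matrix n n ℂ) * (1 - (2 : ℂ) • E) - ((2 * w - 1 : ℝ) : ℂ) • 1)ᴴ *
        ((U : Matrix n n ℂ) * (1 - (2 : ℂ) • E) - ((2 * w - 1 : ℝ) : ℂ) • 1) =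
      (4 * (2 * w - 1) : ℝ) • H := by
    have hEPE : E * P * E = (w : ℂ) • E := by
      ext a b
      have : (w : ℂ) = x j * star (x j) := by
        rw [hw, Complex.star_def, Complex.mul_conj', Complex.ofReal_pow]
      rw [this]
      simp [hP, hE, Matrix.single_mul_mul_single, vecMulVec_apply, Matrix.single_apply]
    have hsq : √(1 - 4 * (w - 1 / 2) ^ 2) ^ 2 = 1 - (2 * w - 1) ^ 2 := by
      rw [Real.sq_sqrt (by nlinarith)]
      ring
    have hH' : H = ((1 - w : ℝ) : ℂ) • 1 - E - P + E * P + P * E := by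
      have : N = P - E * P - P * E + (w : ℂ) • E := by
        rw [hN, hF, ← hEPE]
        noncomm_ring
      rw [hH, this, hF]
      push_cast
      module
    obtain ⟨R, hR⟩ : ∃ R : Matrix n n ℂ, R = (U : Matrix n n ℂ) * (1 - (2 : ℂ) • E) := ⟨_, rfl⟩
    have hR1 : R = 1 - (2 : ℂ) • E - (2 : ℂ) • P + (4 : ℂ) • (P * E) := by
      rw [hR, hU]
      simp only [Matrix.sub_mul, Matrix.mul_sub, Matrix.smul_mul, Matrix.mul_smul, Matrix.mul_one,
        Matrix.one_mul]
      module
    have hR2 : Rᴴ = 1 - (2 : ℂ) • E - (2 : ℂ) • P + (4 : ℂ) • (E * P) := by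
      rw [hR1]
      simp only [conjTranspose_add, conjTranspose_sub, conjTranspose_smul, conjTranspose_mul,
        conjTranspose_one, hEH, hPH]
      simp
    have hRR : Rᴴ * R = 1 := by
      have hUU : (U : Matrix n n ℂ)ᴴ * (U : Matrix n n ℂ) = 1 :=
        Matrix.mem_unitaryGroup_iff'.1 U.2
      rw [hR, conjTranspose_mul, Matrix.mul_assoc, ← Matrix.mul_assoc _ (U : Matrix n n ℂ), hUU,
        Matrix.one_mul, conjTranspose_sub, conjTranspose_smul, hEH, conjTranspose_one,
        Matrix.sub_mul, Matrix.mul_sub, Matrix.smul_mul, Matrix.mul_smul, Matrix.mul_sub,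
        Matrix.mul_smul, hEE]
      simp only [Matrix.mul_one, Matrix.one_mul, star_ofNat]
      module
    rw [← hR, conjTranspose_sub, conjTranspose_smul, conjTranspose_one, Matrix.sub_mul,
      Matrix.mul_sub, hRR, Matrix.smul_mul, Matrix.one_mul, Matrix.mul_smul, Matrix.mul_one,
      Complex.star_def, Complex.conj_ofReal, hR2, hR1, hH', hsq, ← Complex.coe_smul,
      ← Complex.coe_smul]
    push_cast
    module
  rw [hD, hfin]
  exact hHpos.smul (by linarith)

/-- If one weight exceeds one half, a pure state attains the rotation bound. -/
theorem exists_pure_rotation (hx : ∑ i, ‖x i‖ ^ 2 = 1)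
    (hU : (U : Matrix n n ℂ) = 1 - (2 : ℂ) • vecMulVec x (star x)) (j : n)
    (hj : 1 / 2 < ‖x j‖ ^ 2) :
    ∃ φ : n → ℂ, ∑ i, ‖φ i‖ ^ 2 = 1 ∧ 2 * √(1 - 4 * (‖x j‖ ^ 2 - 1 / 2) ^ 2) ≤
      ∑ i, |‖((U : Matrix n n ℂ)ᴴ *ᵥ star φ) i‖ ^ 2 - ‖φ i‖ ^ 2| := by
  set w : ℝ := ‖x j‖ ^ 2 with hw
  have hsplit := Finset.add_sum_erase Finset.univ (fun i => ‖x i‖ ^ 2) (Finset.mem_univ j)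
  rw [hx] at hsplit
  have hrest : ∑ i ∈ Finset.univ.erase j, ‖x i‖ ^ 2 = 1 - w := by linarith
  have hw1 : w ≤ 1 := by
    have : 0 ≤ ∑ i ∈ Finset.univ.erase j, ‖x i‖ ^ 2 := Finset.sum_nonneg fun i _ => sq_nonneg _
    linarith
  rcases hw1.eq_or_lt with h1 | h1
  -- For `w = 1` the bound is zero and any unit vector serves.
  · refine ⟨Pi.single j 1, ?_, ?_⟩
    · rw [Finset.sum_eq_single j] <;> simp +contextual
    · rw [h1]
      norm_num
      exact Finset.sum_nonneg fun i _ => abs_nonneg _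
  set a := √w with ha
  set b := √(1 - w) with hb
  have ha2 : a ^ 2 = w := Real.sq_sqrt (by linarith)
  have hb2 : b ^ 2 = 1 - w := Real.sq_sqrt (by linarith)
  have ha0 : 0 < a := Real.sqrt_pos.2 (by linarith)
  have hb0 : 0 < b := Real.sqrt_pos.2 (by linarith)
  have hab : √(1 - 4 * (w - 1 / 2) ^ 2) = 2 * (a * b) := by
    rw [show 1 - 4 * (w - 1 / 2) ^ 2 = (2 * (a * b)) ^ 2 by
      rw [mul_pow, mul_pow, ha2, hb2]; ring]
    exact Real.sqrt_sq (by positivity)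
  set q : ℝ := √2 with hq
  have hq2 : q ^ 2 = 2 := Real.sq_sqrt (by norm_num)
  have hq0 : 0 < q := Real.sqrt_pos.2 (by norm_num)
  -- In the plane of `e_j` and `x`, the vector `x` has coordinates `(a, b) = (cos θ, sin θ)`. The
  -- scalings `u`, `t` turn it into `(cos (θ - π/4), sin (θ - π/4))`, so the reflection turns the
  -- state by a right angle and the probability of outcome `j` changes by `2 a b = sin 2θ`.
  set u : ℝ := (a + b) / (a * q) with hu
  set t : ℝ := (b - a) / (b * q) with ht
  have hu2 : a ^ 2 * u ^ 2 = (a + b) ^ 2 / 2 := by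
    rw [hu, div_pow, mul_pow, hq2]; field_simp
  have ht2 : b ^ 2 * t ^ 2 = (b - a) ^ 2 / 2 := by
    rw [ht, div_pow, mul_pow, hq2]; field_simp
  let ψ : n → ℂ := fun i => ((if i = j then u else t : ℝ) : ℂ) * x i
  have hψj : ψ j = u * x j := by simp [ψ]
  have hψ : ∀ i, i ≠ j → ψ i = t * x i := fun i hi => by simp [ψ, hi]
  have hs : ∑ i, star (x i) * ψ i = ((1 / q : ℝ) : ℂ) := by
    have h2 : ∀ i, star (x i) * ψ i = ((if i = j then u else t) * ‖x i‖ ^ 2 : ℝ) := fun i => by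
      have : (star (x i) * x i) = ((‖x i‖ ^ 2 : ℝ) : ℂ) := by
        rw [Complex.star_def, Complex.conj_mul', Complex.ofReal_pow]
      rw [Complex.ofReal_mul, ← this]
      simp only [ψ]
      ring
    simp only [h2]
    rw [← Complex.ofReal_sum, ← Finset.add_sum_erase _ _ (Finset.mem_univ j),
      Finset.sum_congr rfl (g := fun i => t * ‖x i‖ ^ 2)
        (fun i hi => by simp [Finset.ne_of_mem_erase hi]), ← Finset.mul_sum, hrest]
    congr 1
    simp only [if_true]
    rw [← hw, ← hb2, ← ha2, hu, ht]
    have : a ^ 2 + b ^ 2 = 1 := by rw [ha2, hb2]; ring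
    field_simp
    linear_combination this
  have hUψ : ∀ i, ((U : Matrix n n ℂ)ᴴ *ᵥ ψ) i = ψ i - 2 * ((1 / q : ℝ) : ℂ) * x i := fun i => by
    rw [reflection_conjTranspose_mulVec hU, hs]
  have hrot : ∀ (r : ℝ) (i : n), ‖(r : ℂ) * x i - 2 * ((1 / q : ℝ) : ℂ) * x i‖ ^ 2 -
      ‖(r : ℂ) * x i‖ ^ 2 = ‖x i‖ ^ 2 * (2 - 4 * r / q) := fun r i => by
    have h3 : (r : ℂ) * x i - 2 * ((1 / q : ℝ) : ℂ) * x i = ((r - 2 / q : ℝ) : ℂ) * x i := by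
      push_cast; ring
    rw [h3, norm_mul, norm_mul, mul_pow, mul_pow, Complex.norm_real, Complex.norm_real,
      Real.norm_eq_abs, Real.norm_eq_abs, sq_abs, sq_abs]
    field_simp
    linear_combination ‖x i‖ ^ 2 * (r ^ 2 - 2) * hq2 - ‖x i‖ ^ 2 * r ^ 2 * hq2
  refine ⟨star ψ, ?_, ?_⟩
  · simp only [Pi.star_apply, norm_star]
    rw [← Finset.add_sum_erase _ _ (Finset.mem_univ j), hψj,
      Finset.sum_congr rfl (g := fun i => t ^ 2 * ‖x i‖ ^ 2)
        (fun i hi => by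
          rw [hψ i (Finset.ne_of_mem_erase hi), norm_mul, mul_pow, Complex.norm_real,
            Real.norm_eq_abs, sq_abs]), ← Finset.mul_sum, hrest, norm_mul, mul_pow,
      Complex.norm_real, Real.norm_eq_abs, sq_abs, ← hw, ← hb2, ← ha2]
    have : a ^ 2 + b ^ 2 = 1 := by rw [ha2, hb2]; ring
    linear_combination hu2 + ht2 + this
  · simp only [star_star, Pi.star_apply, norm_star, hUψ]
    rw [hab, ← Finset.add_sum_erase _ _ (Finset.mem_univ j), hψj, hrot,
      Finset.sum_congr rfl (g := fun i => |2 - 4 * t / q| * ‖x i‖ ^ 2)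
        (fun i hi => by
          rw [hψ i (Finset.ne_of_mem_erase hi), hrot, abs_mul, abs_of_nonneg (sq_nonneg _),
            mul_comm]), ← Finset.mul_sum, hrest, ← hw, ← hb2, ← ha2]
    have e1 : a ^ 2 * (2 - 4 * u / q) = -(2 * (a * b)) := by
      rw [hu]; field_simp; rw [hq2]; ring
    have e2 : 2 - 4 * t / q = 2 * a / b := by
      rw [ht]; field_simp; rw [hq2]; ring
    rw [e1, e2, abs_neg, abs_of_pos (by positivity), abs_of_pos (by positivity)]
    apply le_of_eq
    field_simp
    ring

/-- A pure state with disjointly supported outputs splits the weights into two halves. -/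
theorem exists_sum_eq_half_of_pure
    (hU : (U : Matrix n n ℂ) = 1 - (2 : ℂ) • vecMulVec x (star x)) {ψ : n → ℂ}
    (hψ : ∑ i, ‖ψ i‖ ^ 2 = 1)
    (h : ∀ i, ψ i ≠ 0 → ((U : Matrix n n ℂ)ᴴ *ᵥ ψ) i = 0) :
    ∃ Δ : Finset n, ∑ i ∈ Δ, ‖x i‖ ^ 2 = 1 / 2 := by
  set s := ∑ a, star (x a) * ψ a with hs
  have h1 : ∀ i, ψ i ≠ 0 → ψ i = 2 * s * x i := fun i hi => by
    have := h i hi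
    rw [reflection_conjTranspose_mulVec hU, ← hs] at this
    linear_combination this
  have hs0 : s ≠ 0 := by
    intro h0
    have : ∀ i, ψ i = 0 := fun i => by
      by_contra hi
      exact hi (by rw [h1 i hi, h0]; simp)
    simp [this] at hψ
  refine ⟨Finset.univ.filter fun i => ψ i ≠ 0, ?_⟩
  -- Substituting `ψ = 2 s x` on its support into the definition of `s`.
  have h2 : s = 2 * s * ((∑ i ∈ Finset.univ.filter fun i => ψ i ≠ 0, ‖x i‖ ^ 2 : ℝ) : ℂ) := by
    conv_lhs => rw [hs]
    rw [Complex.ofReal_sum, Finset.mul_sum, Finset.sum_filter]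
    refine Finset.sum_congr rfl fun i _ => ?_
    split_ifs with hi
    · conv_lhs => rw [h1 i hi]
      rw [Complex.ofReal_pow, ← Complex.conj_mul', Complex.star_def]
      ring
    · rw [not_not.1 hi, mul_zero]
  have h3 : (1 : ℂ) = 2 * ((∑ i ∈ Finset.univ.filter fun i => ψ i ≠ 0, ‖x i‖ ^ 2 : ℝ) : ℂ) := by
    apply mul_left_cancel₀ hs0
    linear_combination h2
  have h4 : (1 : ℝ) = 2 * ∑ i ∈ Finset.univ.filter fun i => ψ i ≠ 0, ‖x i‖ ^ 2 := by
    exact_mod_cast h3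
  linarith

theorem exists_sum_eq_half_of_sum_abs_eq_two
    (hU : (U : Matrix n n ℂ) = 1 - (2 : ℂ) • vecMulVec x (star x)) {φ : n → ℂ}
    (hφ : ∑ i, ‖φ i‖ ^ 2 = 1)
    (h : ∑ i, |‖((U : Matrix n n ℂ)ᴴ *ᵥ star φ) i‖ ^ 2 - ‖φ i‖ ^ 2| = 2) :
    ∃ Δ : Finset n, ∑ i ∈ Δ, ‖x i‖ ^ 2 = 1 / 2 := by
  have hφ' : ∑ i, ‖(star φ) i‖ ^ 2 = 1 := by simpa using hφ
  have hsum := sum_norm_sq_unitary_mulVec U (star φ)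
  rw [hφ'] at hsum
  -- The right sides add up to 2, so equality holds termwise and the two distributions have disjoint
  -- supports.
  have hle : ∀ i ∈ Finset.univ, |‖((U : Matrix n n ℂ)ᴴ *ᵥ star φ) i‖ ^ 2 - ‖φ i‖ ^ 2| ≤
      ‖((U : Matrix n n ℂ)ᴴ *ᵥ star φ) i‖ ^ 2 + ‖φ i‖ ^ 2 := fun i _ =>
    abs_le.2 ⟨by nlinarith [sq_nonneg ‖((U : Matrix n n ℂ)ᴴ *ᵥ star φ) i‖],
      by nlinarith [sq_nonneg ‖φ i‖]⟩
  have heq := (Finset.sum_eq_sum_iff_of_le hle).1 (by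
    rw [h, Finset.sum_add_distrib, hsum, hφ]; norm_num)
  refine exists_sum_eq_half_of_pure hU hφ' fun i hi => ?_
  have hi' : 0 < ‖φ i‖ ^ 2 := by
    have : φ i ≠ 0 := fun h0 => hi (by simp [h0])
    positivity
  have h1 := heq i (Finset.mem_univ i)
  rcases abs_cases (‖((U : Matrix n n ℂ)ᴴ *ᵥ star φ) i‖ ^ 2 - ‖φ i‖ ^ 2) with ⟨h2, -⟩ | ⟨h2, -⟩
  · linarith
  · have : ‖((U : Matrix n n ℂ)ᴴ *ᵥ star φ) i‖ ^ 2 = 0 := by linarith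
    simpa using this

theorem exists_pure_of_sum_eq_half (hx : ∑ i, ‖x i‖ ^ 2 = 1)
    (hU : (U : Matrix n n ℂ) = 1 - (2 : ℂ) • vecMulVec x (star x)) {Δ : Finset n}
    (hΔ : ∑ i ∈ Δ, ‖x i‖ ^ 2 = 1 / 2) :
    ∃ φ : n → ℂ, ∑ i, ‖φ i‖ ^ 2 = 1 ∧
      ∑ i, |‖((U : Matrix n n ℂ)ᴴ *ᵥ star φ) i‖ ^ 2 - ‖φ i‖ ^ 2| = 2 := by
  set q : ℝ := √2 with hq
  have hq2 : q ^ 2 = 2 := Real.sq_sqrt (by norm_num)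
  have hq0 : 0 < q := Real.sqrt_pos.2 (by norm_num)
  -- The reflection subtracts `√2 x` from `ψ`, leaving `-√2 x` on the complement of `Δ` and nothing
  -- on `Δ`.
  let ψ : n → ℂ := fun i => if i ∈ Δ then (q : ℂ) * x i else 0
  have hs : 2 * ∑ i, star (x i) * ψ i = (q : ℂ) := by
    have h2 : ∀ i, star (x i) * ψ i = if i ∈ Δ then (q : ℂ) * ((‖x i‖ ^ 2 : ℝ) : ℂ) else 0 :=
      fun i => by
        simp only [ψ]
        split_ifs
        · rw [Complex.ofReal_pow, ← Complex.conj_mul', Complex.star_def]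
          ring
        · simp
    simp only [h2]
    rw [Finset.sum_ite_mem, Finset.univ_inter, ← Finset.mul_sum, ← Complex.ofReal_sum, hΔ]
    push_cast
    ring
  have hnorm : ∀ i, ‖(q : ℂ) * x i‖ ^ 2 = 2 * ‖x i‖ ^ 2 := fun i => by
    rw [norm_mul, mul_pow, Complex.norm_real, Real.norm_eq_abs, sq_abs, hq2]
  refine ⟨star ψ, ?_, ?_⟩
  · have h3 : ∀ i, ‖(star ψ) i‖ ^ 2 = if i ∈ Δ then 2 * ‖x i‖ ^ 2 else 0 := fun i => by
      simp only [Pi.star_apply, norm_star, ψ]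
      split_ifs
      · exact hnorm i
      · simp
    simp only [h3]
    rw [Finset.sum_ite_mem, Finset.univ_inter, ← Finset.mul_sum, hΔ]
    norm_num
  · have h3 : ∀ i, |‖((U : Matrix n n ℂ)ᴴ *ᵥ star (star ψ)) i‖ ^ 2 - ‖(star ψ) i‖ ^ 2| =
        2 * ‖x i‖ ^ 2 := fun i => by
      rw [star_star, reflection_conjTranspose_mulVec hU, hs]
      simp only [Pi.star_apply, norm_star, ψ]
      split_ifs
      · rw [sub_self, hnorm]
        simp
      · rw [zero_sub, norm_neg, hnorm]
        simp
    simp only [h3]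
    rw [← Finset.mul_sum, hx, mul_one]

end Reflection

end QMeas

/-! ### The two regimes of `ω` combined. -/

theorem mainTheorem8 (d : ℕ) (x : EuclideanSpace ℂ (Fin d)) (hx : ‖x‖ = 1)
    (U : Matrix.unitaryGroup (Fin d) ℂ)
    (hU : (U : Matrix (Fin d) (Fin d) ℂ) =
      1 - (2 : ℂ) • Matrix.vecMulVec (fun i => x i) (fun i => star (x i)))
    (ω : ℝ) (hω : IsGreatest (Set.range fun i => ‖x i‖ ^ 2) ω) :
    (QMeas.PerfectlyDistinguishable (QMeas.vonNeumann U) (QMeas.vonNeumann 1) ↔ ω ≤ 1 / 2) ∧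
    (QMeas.diamondNorm (QMeas.vonNeumann U - QMeas.vonNeumann 1) = 2 ↔ ω ≤ 1 / 2) ∧
    (∃ ρ : Matrix (Fin d) (Fin d) ℂ,
      QMeas.IsDiscriminator (QMeas.vonNeumann U - QMeas.vonNeumann 1) ρ ∧ ρ.rank ≤ 2) ∧
    ((QMeas.diamondNorm (QMeas.vonNeumann U - QMeas.vonNeumann 1) = 2 ∧
        ∃ ρ : Matrix (Fin d) (Fin d) ℂ,
          QMeas.IsDiscriminator (QMeas.vonNeumann U - QMeas.vonNeumann 1) ρ ∧ ρ.rank = 1) ↔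
      ∃ Δ : Finset (Fin d), ∑ i ∈ Δ, ‖x i‖ ^ 2 = 1 / 2) ∧
    (1 / 2 < ω →
      QMeas.diamondNorm (QMeas.vonNeumann U - QMeas.vonNeumann 1) =
        2 * √(1 - 4 * (ω - 1 / 2) ^ 2)) := by
  have hx1 : ∑ i, ‖x i‖ ^ 2 = 1 := by
    rw [← EuclideanSpace.norm_sq_eq, hx, one_pow]
  have hU' : (U : Matrix (Fin d) (Fin d) ℂ) =
      1 - (2 : ℂ) • Matrix.vecMulVec (fun i => x i) (star fun i => x i) := hU
  obtain ⟨⟨j, hj⟩, hmax⟩ := hω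
  have hj : ‖x j‖ ^ 2 = ω := hj
  have hmax : ∀ i, ‖x i‖ ^ 2 ≤ ω := fun i => hmax ⟨i, rfl⟩
  have : Nonempty (Fin d) := ⟨j⟩
  have hsmall : ω ≤ 1 / 2 → QMeas.PerfectlyDistinguishable (QMeas.vonNeumann U)
      (QMeas.vonNeumann 1) ∧ QMeas.diamondNorm (QMeas.vonNeumann U - QMeas.vonNeumann 1) = 2 ∧
      ∃ ρ : Matrix (Fin d) (Fin d) ℂ,
        QMeas.IsDiscriminator (QMeas.vonNeumann U - QMeas.vonNeumann 1) ρ ∧ ρ.rank ≤ 2 := by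
    intro h
    obtain ⟨ρ, hρ, hrank, horth⟩ := QMeas.exists_state_rank_le_two hx1 hU'
      fun i => (hmax i).trans h
    obtain ⟨h1, h2⟩ := QMeas.isDiscriminator_of_le hρ (QMeas.diamondNorm_le_two U)
      (QMeas.traceNorm_sandwich_eq_two hρ horth).ge
    exact ⟨QMeas.perfectlyDistinguishable_of_state hρ horth, h1, ρ, h2, hrank⟩
  have hbig : 1 / 2 < ω → ¬ QMeas.PerfectlyDistinguishable (QMeas.vonNeumann U)
      (QMeas.vonNeumann 1) ∧ QMeas.diamondNorm (QMeas.vonNeumann U - QMeas.vonNeumann 1) =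
        2 * √(1 - 4 * (ω - 1 / 2) ^ 2) ∧
      ∃ ρ : Matrix (Fin d) (Fin d) ℂ,
        QMeas.IsDiscriminator (QMeas.vonNeumann U - QMeas.vonNeumann 1) ρ ∧ ρ.rank ≤ 2 := by
    intro h
    rw [← hj] at h
    have hδ : ∀ i : Fin d, (if i = j then -1 else 1 : ℂ) * star (if i = j then -1 else 1 : ℂ) = 1 :=
      fun i => by split_ifs <;> simp
    have hpsd := QMeas.posSemidef_reflection_mul_reflection hx1 hU' j h
    obtain ⟨φ, hφ, hle⟩ := QMeas.exists_pure_rotation hx1 hU' j h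
    rw [← QMeas.traceNorm_sandwich_vecMulVec U hφ] at hle
    obtain ⟨h1, h2⟩ := QMeas.isDiscriminator_of_le (QMeas.isState_vecMulVec hφ)
      (QMeas.diamondNorm_le U hδ _ (Real.sqrt_nonneg _) hpsd) hle
    rw [hj] at h1
    refine ⟨fun hpd => ?_, h1, _, h2, (Matrix.rank_vecMulVec_le _ _).trans one_le_two⟩
    have h3 := QMeas.one_le_of_perfectlyDistinguishable U hδ _ (Real.sqrt_nonneg _) hpsd hpd
    rw [Real.one_le_sqrt] at h3
    nlinarith
  have hlt : 1 / 2 < ω → 2 * √(1 - 4 * (ω - 1 / 2) ^ 2) ≠ 2 := fun h heq => by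
    have h1 : √(1 - 4 * (ω - 1 / 2) ^ 2) = 1 := by linarith
    rw [Real.sqrt_eq_one] at h1
    nlinarith
  refine ⟨⟨fun h => ?_, fun h => (hsmall h).1⟩, ⟨fun h => ?_, fun h => (hsmall h).2.1⟩, ?_, ?_,
    fun h => (hbig h).2.1⟩
  · by_contra! hcon
    exact (hbig hcon).1 h
  · by_contra! hcon
    exact hlt hcon ((hbig hcon).2.1.symm.trans h)
  · rcases le_or_gt ω (1 / 2) with h | h
    · exact (hsmall h).2.2
    · exact (hbig h).2.2
  · constructor
    · rintro ⟨h2, ρ, ⟨hρ, hnorm⟩, hrank⟩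
      obtain ⟨φ, hφ, rfl⟩ := hρ.exists_eq_vecMulVec hrank
      rw [h2, QMeas.traceNorm_sandwich_vecMulVec U hφ] at hnorm
      exact QMeas.exists_sum_eq_half_of_sum_abs_eq_two hU' hφ hnorm.symm
    · rintro ⟨Δ, hΔ⟩
      obtain ⟨φ, hφ, hsum⟩ := QMeas.exists_pure_of_sum_eq_half hx1 hU' hΔ
      rw [← QMeas.traceNorm_sandwich_vecMulVec U hφ] at hsum
      obtain ⟨h1, h2⟩ := QMeas.isDiscriminator_of_le (QMeas.isState_vecMulVec hφ)
        (QMeas.diamondNorm_le_two U) hsum.ge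
      refine ⟨h1, _, h2, le_antisymm (Matrix.rank_vecMulVec_le _ _) ?_⟩
      by_contra! hcon
      -- Rank zero would make the state vanish, against its trace one.
      have h0 : Matrix.vecMulVec φ (star φ) = 0 := by
        rw [Nat.lt_one_iff, Matrix.rank, Submodule.finrank_eq_zero, LinearMap.range_eq_bot] at hcon
        exact Matrix.mulVec_injective (funext fun v => by simpa using LinearMap.congr_fun hcon v)
      have := (QMeas.isState_vecMulVec hφ).2
      rw [h0] at this
      simp at this
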